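/- **Model.** There are $k$ sites $P_1,\dots,P_k$; site $P_i$ holds an input $x_i$. A deterministic protocol in the point-to-point message-passing model transmits one bit at a time between two distinct sites. The transcript so far determines which site speaks next and to whom, or that the protocol has stopped. The bit that a site sends depends only on its own input and on its own view, i.e. on the bits exchanged so far on its own channels (with the identities of their senders and receivers). Whenever a site takes part in the next transmission, its own view determines who the other party is (so the choice of a communication partner does not carry uncounted information). When the protocol stops, one site, determined by the transcript, outputs an answer depending on its input and its view. For a function $f$, a distribution $\mu$ on inputs and $\delta\ge 0$, let $D^{\delta}_{\mu}(f)$ be the minimum, over deterministic protocols whose output differs from $f(x_1,\dots,x_k)$ (or that do not stop) with probability at most $\delta$ when $(x_1,\dots,x_k)\sim\mu$, of the worst-case (over all inputs) number of transmitted bits. **Problem.** Each site holds a vector $x_i\in\{0,1\}^r$, and for an integer $\theta$, $\mathrm{THRESH}^r_{\theta}(x_1,\dots,x_k)=1$ if $\sum_{j=1}^{r}\bigvee_{i=1}^k x_{i,j}\ge\theta+1$, and $0$ if this sum is at most $\theta$. **Distribution.** Let $4\mid r+1$ and $\ell=(r+1)/4$. Let $\tau_\beta$ be the distribution on pairs $(X,Y)$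 of subsets of $[r]$ which with probability $\beta$ is uniform over the pairs with $|X|=|Y|=\ell$, $|X\cap Y|=1$, and with probability $1-\beta$ is uniform over the pairs with $|X|=|Y|=\ell$, $X\cap Y=\emptyset$. With $\beta=1/k^2$, pick $(X_1,Y)\sim\tau_\beta$ and, given $Y$, pick $X_2,\dots,X_k$ independently from the conditional distribution of the first set given $Y$. Let $\zeta=\zeta_{k,r}$ be the distribution of the characteristic vectors of $(X_1,\dots,X_k)$. **Theorem.** There are absolute constants $c>0$ and $c_k>0$ such that for all positive integers $k,r$ with $4\mid r+1$ and $c_k\log_2 r\le k\le r$, $$D^{1/k^4}_{\zeta}\bigl(\mathrm{THRESH}^r_{(3r-1)/4}\bigr)\ \ge\ c\,k\,r .$$ -/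

import Mathlib

/-! ### Deterministic protocols in the point-to-point message-passing model -/

/-- One bit travelling over a private channel: (sender, receiver, bit). -/
abbrev Event (k : ℕ) : Type := Fin k × Fin k × Bool

/-- A transcript is the chronological list of all transmitted bits. -/
abbrev Transcript (k : ℕ) : Type := List (Event k)

/-- What site `i` sees of a transcript: the bits that it sent or received itself. -/
def view {k : ℕ} (i : Fin k) (h : Transcript k) : Transcript k :=
  h.filter (fun e => decide (e.1 = i ∨ e.2.1 = i))

/-- A deterministic protocol for `k` sites, each holding an input from `X`.

The transcript specifies who speaks next and to whom (`turn`), or that the protocol has stopped.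
The bit sent by site `i` depends only on its input and on its own view.  A longer message is a
sequence of bits.  The communication is point-to-point: a site knows the other end of the channel
that it uses next from its own view (`peer`), so identities of sites cannot be used to transmit
uncounted information.  At the end one site, the `reporter`, announces an answer computed from its
input and its own view. -/
structure Protocol (k : ℕ) (X : Type) where
  turn : Transcript k → Option (Fin k × Fin k)
  turn_ne : ∀ h s t, turn h = some (s, t) → s ≠ t
  peer : Fin k → Transcript k → Fin k
  peer_sender : ∀ h s t, turn h = some (s, t) → peer s (view s h) = t
  peer_receiver : ∀ h s t, turn h = some (s, t) → peer t (view t h) = s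
  bit : Fin k → X → Transcript k → Bool
  reporter : Transcript k → Fin k
  answer : Fin k → X → Transcript k → Bool

namespace Protocol

variable {k : ℕ} {X : Type}

/-- Transmit one more bit (or do nothing if the protocol has stopped). -/
def step (P : Protocol k X) (x : Fin k → X) (h : Transcript k) : Transcript k :=
  match P.turn h with
  | none => h
  | some (s, t) => h ++ [(s, t, P.bit s (x s) (view s h))]

/-- The transcript on input `x` after (at most) `n` transmitted bits. -/
def run (P : Protocol k X) (x : Fin k → X) : ℕ → Transcript k
  | 0 => []
  | n + 1 => P.step x (P.run x n)

/-- On input `x` the protocol has stopped after at most `n` bits. -/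
def HaltsBy (P : Protocol k X) (x : Fin k → X) (n : ℕ) : Prop :=
  P.turn (P.run x n) = none

/-- On input `x` the protocol stops and its reporter announces `b`. -/
def Outputs (P : Protocol k X) (x : Fin k → X) (b : Bool) : Prop :=
  ∃ n, P.HaltsBy x n ∧
    P.answer (P.reporter (P.run x n)) (x (P.reporter (P.run x n)))
      (view (P.reporter (P.run x n)) (P.run x n)) = b

/-- The number of bits in the complete transcript on input `x` (`⊤` if it never stops). -/
noncomputable def bits (P : Protocol k X) (x : Fin k → X) : ℕ∞ :=
  ⨅ (n : ℕ) (_ : P.HaltsBy x n), (n : ℕ∞)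

/-- Worst-case communication in bits, over all inputs. -/
noncomputable def cost (P : Protocol k X) : ℕ∞ :=
  ⨆ x : Fin k → X, P.bits x

open Classical in
/-- Probability, for inputs with probability mass function `μ`, that `P` fails to output `f`. -/
noncomputable def errorProb [Fintype X] (P : Protocol k X) (μ : (Fin k → X) → ℝ)
    (f : (Fin k → X) → Bool) : ℝ :=
  ∑ x : Fin k → X, if P.Outputs x (f x) then 0 else μ x

end Protocol

/-- The `δ`-error `μ`-distributional communication complexity of `f`: the least worst-case
communication of a deterministic protocol that errs with `μ`-probability at most `δ`. -/
noncomputable def distComplexity {k : ℕ} {X : Type} [Fintype X] (μ : (Fin k → X) → ℝ)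
    (f : (Fin k → X) → Bool) (δ : ℝ) : ℕ∞ :=
  ⨅ (P : Protocol k X) (_ : P.errorProb μ f ≤ δ), P.cost

/-! ### The problem -/

/-- The threshold problem: do more than `θ` columns of the `k × r` bit matrix contain a `1`? -/
def thresh {k r : ℕ} (θ : ℕ) (x : Fin k → Fin r → Bool) : Bool :=
  decide (θ < (Finset.univ.filter (fun j : Fin r => ∃ i : Fin k, x i j = true)).card)

/-! ### The hard distribution, through probability mass functions -/

/-- Mass function of the uniform distribution on a finite nonempty set. -/
noncomputable def uniformMass {α : Type} [DecidableEq α] (s : Finset α) (a : α) : ℝ :=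
  if a ∈ s then 1 / (s.card : ℝ) else 0

/-- Pairs of subsets of size `(r + 1) / 4` that meet in exactly `m` elements. -/
def pairsMeetingIn (r m : ℕ) : Finset (Finset (Fin r) × Finset (Fin r)) :=
  Finset.univ.filter (fun p => 4 * p.1.card = r + 1 ∧ 4 * p.2.card = r + 1 ∧ (p.1 ∩ p.2).card = m)

/-- The set-disjointness distribution: with probability `β` a uniformly random pair of sets of
size `(r + 1) / 4` with exactly one common element, otherwise a uniformly random disjoint pair. -/
noncomputable def tau (r : ℕ) (β : ℝ) (p : Finset (Fin r) × Finset (Fin r)) : ℝ :=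
  β * uniformMass (pairsMeetingIn r 1) p + (1 - β) * uniformMass (pairsMeetingIn r 0) p

/-- The marginal of the second coordinate. -/
noncomputable def sndMarginal {A B : Type} [Fintype A] (μ : A × B → ℝ) (y : B) : ℝ :=
  ∑ x : A, μ (x, y)

/-- The conditional distribution of the first coordinate given the second. -/
noncomputable def condMass {A B : Type} [Fintype A] (μ : A × B → ℝ) (x : A) (y : B) : ℝ :=
  μ (x, y) / sndMarginal μ y

/-- The distribution `ν` of `(X₁, …, X_k, Y)`: `Y` follows the marginal of `μ` and, given `Y`, the
`Xᵢ` are independent copies from `μ | Y`.  (For `k ≥ 1` this is the same as picking `(X₁, Y)`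
from `μ` and then `X₂, …, X_k` independently from `μ | Y`.) -/
noncomputable def nu {A B : Type} [Fintype A] (k : ℕ) (μ : A × B → ℝ) (x : Fin k → A) (y : B) : ℝ :=
  sndMarginal μ y * ∏ i : Fin k, condMass μ (x i) y

/-- The hard input distribution `ζ`: the characteristic vectors of `X₁, …, X_k`, where
`(X₁, …, X_k, Y)` follows `ν` built from `tau` with `β = 1 / k²`. -/
noncomputable def zeta (k r : ℕ) (x : Fin k → Fin r → Bool) : ℝ :=
  ∑ y : Finset (Fin r),
    nu k (tau r (1 / (k : ℝ) ^ 2)) (fun i => Finset.univ.filter (fun j => x i j = true)) y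

/-!
The lower bound reduces the `k`-party problem to two-party set disjointness.

Let `r = 4 l - 1`.  Two planted laws are compared (`plantedLaw`): a set `y` of size `l` is random,
and either all the sets `x₁, …, x_k` are uniform among those disjoint from `y`, or this holds for
all but `x_i`, which meets `y` in one element.  The hard distribution with `β = 1 / k²` dominates
the first law up to a factor `1 / 2` and the second up to a factor `β / 2` (`zeta_ge_plantedLaw`),
so a protocol with error `1 / k⁴` errs rarely under both.  In the first case at most `3 l - 1`
elements are covered and the answer must be `false`.  In the second case the other sets cover the
complement of `y` except with probability `r (2 / 3) ^ (k - 1)`, and then the answer must be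
`true` (`sum_plantedLaw_one_thresh_false_le`).

If the protocol has cost `C`, some site `i` sees at most `2 C / k` bits on average under the first
law, which does not depend on `i`.  Consider the inputs that are answered `false` and on which site
`i` sees at most `T` bits.  As site `i` knows the other end of each channel it uses, there are
at most `4 ^ (T + 1)` such views (`Protocol.card_shortViews_le`), and each of them, with the
information whether `i` is the reporter, gives a set of inputs that is a rectangle with respect to
`x_i` and the other inputs (`Protocol.isRectangle_viewClass`).  Since inputs on which `i` sees more
than `T` bits are simply left out, the expected communication only matters under the first law, by
Markov's inequality.

Given `y`, the input of site `i` is independent of the others, so a rectangle is a two-party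
rectangle between `x_i` and `y`, with weights in `[0, 1]` on the side of `y`.  Razborov's bound
(`disjointness_corruption`, `plantedLaw_corruption`) says that the mass of a rectangle under the
second law is at least `1 / 128` of its mass under the first, up to an error exponentially small
in `l`.  Summing over the rectangles, with `T` a small multiple of `l`, gives a contradiction
unless `C` is at least a constant times `k r` (`corruption_of_cost_le`).

Razborov's bound is proved by double counting over the splittings of the ground set into a set `T`
of `2 l - 1` elements, an element `i`, and the rest.  Each disjoint pair arises from the same number
of splittings, as does each pair meeting in one element.  For a fixed set `S` of `2 l` elements and
a family of `l`-element subsets of `S` that is not exponentially small, all but a quarter of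
the elements of `S`, weighted by the members that avoid them, lie in a constant fraction as many
members as avoid them (`sum_rareElements_le`).  Hence at least half of the splittings, weighted by
disjoint pairs, are good for both families, and these provide the pairs meeting in `i`.
-/

/-! ### Runs of a protocol -/

namespace Protocol

variable {k : ℕ} {X : Type}

lemma run_eq_of_haltsBy (P : Protocol k X) {x : Fin k → X} {n m : ℕ} (h : P.HaltsBy x n)
    (hnm : n ≤ m) : P.run x m = P.run x n := by
  induction m, hnm using Nat.le_induction with
  | base => rfl
  | succ m _ ih =>
    have h' : P.turn (P.run x n) = none := h
    simp [run, ih, step, h']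

lemma HaltsBy.mono {P : Protocol k X} {x : Fin k → X} {n m : ℕ} (h : P.HaltsBy x n)
    (hnm : n ≤ m) : P.HaltsBy x m := by
  unfold HaltsBy
  rw [P.run_eq_of_haltsBy h hnm]
  exact h

lemma haltsBy_of_cost_le {P : Protocol k X} {C : ℕ} (hC : P.cost ≤ C) (x : Fin k → X) :
    P.HaltsBy x C := by
  have h1 : P.bits x ≤ C := (le_iSup P.bits x).trans hC
  by_contra hn
  have h2 : ((C + 1 : ℕ) : ℕ∞) ≤ P.bits x := by
    refine le_iInf₂ fun n h => ?_
    have : C < n := by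
      by_contra hlt
      exact hn (h.mono (not_lt.1 hlt))
    exact_mod_cast this
  have h3 := h2.trans h1
  have : C + 1 ≤ C := by exact_mod_cast h3
  omega

/-- The answer announced after `C` bits. -/
def outputAt (P : Protocol k X) (C : ℕ) (x : Fin k → X) : Bool :=
  P.answer (P.reporter (P.run x C)) (x (P.reporter (P.run x C)))
    (view (P.reporter (P.run x C)) (P.run x C))

lemma outputs_iff {P : Protocol k X} {C : ℕ} {x : Fin k → X} (h : P.HaltsBy x C) (b : Bool) :
    P.Outputs x b ↔ P.outputAt C x = b := by
  constructor
  · rintro ⟨n, hn, hb⟩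
    have : P.run x C = P.run x n := by
      rw [← P.run_eq_of_haltsBy h (le_max_left C n), ← P.run_eq_of_haltsBy hn (le_max_right C n)]
    unfold outputAt
    rw [this]
    exact hb
  · exact fun hb => ⟨C, h, hb⟩

lemma length_run_le (P : Protocol k X) (x : Fin k → X) (n : ℕ) : (P.run x n).length ≤ n := by
  induction n with
  | zero => simp [run]
  | succ n ih =>
    simp only [run, step]
    split
    · omega
    · simpa using ih

/-- Every transmitted bit is seen by at most two sites. -/
lemma sum_length_view_le (h : Transcript k) : ∑ i, (view i h).length ≤ 2 * h.length := by
  classical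
  induction h with
  | nil => simp [view]
  | cons e h ih =>
    have hone : ∀ i : Fin k, (view i (e :: h)).length ≤
        (view i h).length + ((if e.1 = i then 1 else 0) + (if e.2.1 = i then 1 else 0)) := by
      intro i
      unfold view
      by_cases h1 : e.1 = i <;> by_cases h2 : e.2.1 = i <;> simp [h1, h2]
    refine (Finset.sum_le_sum fun i _ => hone i).trans ?_
    simp only [Finset.sum_add_distrib, Finset.sum_ite_eq, Finset.mem_univ, if_true,
      List.length_cons]
    omega

lemma view_append_singleton (i : Fin k) (h : Transcript k) (e : Event k) :
    view i (h ++ [e]) = if e.1 = i ∨ e.2.1 = i then view i h ++ [e] else view i h := by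
  unfold view
  by_cases he : e.1 = i ∨ e.2.1 = i <;> simp [List.filter_append, he]

lemma run_succ_of_turn {P : Protocol k X} {x : Fin k → X} {n : ℕ} {s t : Fin k}
    (h : P.turn (P.run x n) = some (s, t)) :
    P.run x (n + 1) = P.run x n ++ [(s, t, P.bit s (x s) (view s (P.run x n)))] := by
  simp [run, step, h]

lemma run_succ_of_turn_none {P : Protocol k X} {x : Fin k → X} {n : ℕ}
    (h : P.turn (P.run x n) = none) : P.run x (n + 1) = P.run x n := by
  simp [run, step, h]

/-! ### The view of one site splits the inputs into combinatorial rectangles -/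

/-- The bits that site `i` sends according to its view are those prescribed by its own input. -/
lemma bit_eq_of_prefix_view (P : Protocol k X) (x : Fin k → X) (i t : Fin k) (b : Bool)
    (w : Transcript k) (n : ℕ) (h : w ++ [(i, t, b)] <+: view i (P.run x n)) :
    b = P.bit i (x i) w := by
  induction n with
  | zero => simp [run, view] at h
  | succ n ih =>
    rcases hT : P.turn (P.run x n) with _ | ⟨s, u⟩
    · rw [run_succ_of_turn_none hT] at h
      exact ih h
    · rw [run_succ_of_turn hT, view_append_singleton] at h
      split_ifs at h with hi
      · rcases List.prefix_concat_iff.1 h with h | h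
        · obtain ⟨h1, h2⟩ := List.append_inj' h rfl
          simp only [List.cons.injEq, Prod.mk.injEq, and_true] at h2
          obtain ⟨rfl, rfl, rfl⟩ := h2
          rw [h1]
        · exact ih h
      · exact ih h

lemma view_run_prefix (P : Protocol k X) (x : Fin k → X) (i : Fin k) {n m : ℕ} (h : n ≤ m) :
    view i (P.run x n) <+: view i (P.run x m) := by
  induction m, h using Nat.le_induction with
  | base => exact List.prefix_rfl
  | succ m _ ih =>
    refine ih.trans ?_
    rcases hT : P.turn (P.run x m) with _ | ⟨s, u⟩
    · rw [run_succ_of_turn_none hT]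
    · rw [run_succ_of_turn hT, view_append_singleton]
      split_ifs
      · exact List.prefix_append _ _
      · exact List.prefix_rfl

/-- If site `i` has the same view on two inputs, then replacing its input in the second by that
of the first does not change the transcript. -/
lemma run_update_of_view_eq (P : Protocol k X) (x x' : Fin k → X) (i : Fin k) (C : ℕ)
    (h : view i (P.run x C) = view i (P.run x' C)) {n : ℕ} (hn : n ≤ C) :
    P.run (Function.update x' i (x i)) n = P.run x' n := by
  induction n with
  | zero => rfl
  | succ n ih =>
    have ih := ih (by omega)
    rcases hT : P.turn (P.run x' n) with _ | ⟨s, t⟩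
    · rw [run_succ_of_turn_none hT, run_succ_of_turn_none (by rw [ih]; exact hT), ih]
    · rw [run_succ_of_turn hT, run_succ_of_turn (s := s) (t := t) (by rw [ih]; exact hT), ih]
      by_cases hs : s = i
      · subst hs
        have hp := P.view_run_prefix x' s hn
        rw [run_succ_of_turn hT, view_append_singleton, if_pos (Or.inl rfl), ← h] at hp
        have := P.bit_eq_of_prefix_view x s t _ _ C hp
        simp [this]
      · simp [Function.update_of_ne hs]

/-- A set of inputs is a rectangle with respect to the coordinate `i` if it is the product of a
set of values for coordinate `i` with a set of values for the other coordinates. -/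
def IsRectangle (i : Fin k) (Q : Set (Fin k → X)) : Prop :=
  ∀ x ∈ Q, ∀ x' ∈ Q, Function.update x' i (x i) ∈ Q

/-- The inputs on which site `i` ends with view `v`, the reporter is (or is not) site `i`, and the
answer is `false`. -/
def viewClass (P : Protocol k X) (C : ℕ) (i : Fin k) (v : Transcript k) (b : Bool) :
    Set (Fin k → X) :=
  {x | view i (P.run x C) = v ∧ decide (P.reporter (P.run x C) = i) = b ∧
    P.outputAt C x = false}

lemma isRectangle_viewClass (P : Protocol k X) (C : ℕ) (i : Fin k) (v : Transcript k) (b : Bool) :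
    IsRectangle i (P.viewClass C i v b) := by
  rintro x ⟨hv, hr, ho⟩ x' ⟨hv', hr', ho'⟩
  have hrun := P.run_update_of_view_eq x x' i C (hv.trans hv'.symm) le_rfl
  refine ⟨by rw [hrun]; exact hv', by rw [hrun]; exact hr', ?_⟩
  unfold outputAt at ho ho' ⊢
  rw [hrun]
  by_cases hi : P.reporter (P.run x' C) = i
  · have hi2 : P.reporter (P.run x C) = i := by
      rw [← hr'] at hr
      simpa [hi] using hr
    rw [hi2, hv] at ho
    rw [hi, hv']
    simpa using ho
  · rw [Function.update_of_ne hi]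
    exact ho'

/-! ### Counting the views of one site -/

/-- The view of site `i` recovered from the list, latest bit first, of the transmitted bits, each
with a flag telling whether `i` was the sender.  The other end of the channel is known to `i`. -/
def decodeView (P : Protocol k X) (i : Fin k) : List (Bool × Bool) → Transcript k
  | [] => []
  | p :: l => P.decodeView i l ++
      [if p.1 then (i, P.peer i (P.decodeView i l), p.2)
        else (P.peer i (P.decodeView i l), i, p.2)]

lemma exists_decodeView_eq (P : Protocol k X) (x : Fin k → X) (i : Fin k) (n : ℕ) :
    ∃ l : List (Bool × Bool), l.length = (view i (P.run x n)).length ∧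
      P.decodeView i l = view i (P.run x n) := by
  induction n with
  | zero => exact ⟨[], by simp [run, view, decodeView]⟩
  | succ n ih =>
    obtain ⟨l, hl, hd⟩ := ih
    rcases hT : P.turn (P.run x n) with _ | ⟨s, t⟩
    · rw [run_succ_of_turn_none hT]
      exact ⟨l, hl, hd⟩
    · rw [run_succ_of_turn hT, view_append_singleton]
      by_cases hs : s = i
      · subst hs
        have := P.peer_sender _ _ _ hT
        exact ⟨(true, P.bit s (x s) (view s (P.run x n))) :: l, by
          simp [decodeView, hl, hd, this]⟩
      · by_cases ht : t = i
        · subst ht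
          have := P.peer_receiver _ _ _ hT
          exact ⟨(false, P.bit s (x s) (view s (P.run x n))) :: l, by
            simp [decodeView, hl, hd, this]⟩
        · exact ⟨l, by simp [hs, ht, hl, hd]⟩

open Classical in
/-- The final views of site `i` of length at most `T`. -/
noncomputable def shortViews [Fintype X] (P : Protocol k X) (C : ℕ) (i : Fin k) (T : ℕ) :
    Finset (Transcript k) :=
  (Finset.univ.image fun x => view i (P.run x C)).filter fun v => v.length ≤ T

lemma card_shortViews_le [Fintype X] (P : Protocol k X) (C : ℕ) (i : Fin k) (T : ℕ) :
    (P.shortViews C i T).card ≤ 4 ^ (T + 1) := by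
  classical
  have hsub : P.shortViews C i T ⊆ (Finset.range (T + 1)).biUnion fun t =>
      (Finset.univ : Finset (List.Vector (Bool × Bool) t)).image
        fun l => P.decodeView i l.1 := by
    intro v hv
    simp only [shortViews, Finset.mem_filter, Finset.mem_image, Finset.mem_univ, true_and] at hv
    obtain ⟨⟨x, rfl⟩, hT⟩ := hv
    obtain ⟨l, hl, hd⟩ := P.exists_decodeView_eq x i C
    simp only [Finset.mem_biUnion, Finset.mem_range, Finset.mem_image, Finset.mem_univ, true_and]
    exact ⟨_, Nat.lt_succ_of_le hT, ⟨l, hl⟩, hd⟩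
  refine (Finset.card_le_card hsub).trans (Finset.card_biUnion_le.trans ?_)
  have h4 : ∀ t ∈ Finset.range (T + 1), ((Finset.univ :
      Finset (List.Vector (Bool × Bool) t)).image fun l => P.decodeView i l.1).card ≤ 4 ^ t := by
    intro t _
    refine Finset.card_image_le.trans ?_
    rw [Finset.card_univ, card_vector]
    simp
  refine (Finset.sum_le_sum h4).trans ?_
  have := Nat.geomSum_eq (m := 4) (by norm_num) (T + 1)
  rw [this]
  exact (Nat.div_le_self _ _).trans (Nat.sub_le _ _)

end Protocol

/-! ### Rare elements of a family of sets -/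

/-- Exponential moment bound: few subsets of `S` contain at most a quarter of `I ⊆ S`. -/
lemma card_filter_inter_small_le {V : Type*} [DecidableEq V] {S I : Finset V} (hI : I ⊆ S) :
    ((S.powerset.filter fun x => 4 * (x ∩ I).card ≤ I.card).card : ℝ) ≤
      2 ^ S.card * (97 / 108) ^ I.card := by
  have hsum : ∑ x ∈ S.powerset, ((16 / 81 : ℝ)) ^ (x ∩ I).card =
      (97 / 81) ^ I.card * 2 ^ (S.card - I.card) := by
    have h1 := Finset.prod_one_add (R := ℝ) (f := fun i => if i ∈ I then (16 / 81 : ℝ) else 1) S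
    have h2 : ∀ x ∈ S.powerset, ∏ i ∈ x, (if i ∈ I then (16 / 81 : ℝ) else 1) =
        (16 / 81 : ℝ) ^ (x ∩ I).card := by
      intro x _
      rw [Finset.prod_ite]
      rw [Finset.prod_const, Finset.prod_const_one, mul_one, Finset.filter_mem_eq_inter]
    rw [Finset.sum_congr rfl h2] at h1
    rw [← h1]
    have h3 : ∀ i ∈ S, (1 + if i ∈ I then (16 / 81 : ℝ) else 1) =
        if i ∈ I then (97 / 81 : ℝ) else 2 := by
      intro i _
      split_ifs <;> norm_num
    rw [Finset.prod_congr rfl h3, Finset.prod_ite]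
    simp only [Finset.prod_const]
    rw [Finset.filter_mem_eq_inter, Finset.inter_eq_right.2 hI, Finset.filter_notMem_eq_sdiff,
      Finset.card_sdiff_of_subset hI]
  have hcard := Finset.card_le_card hI
  calc ((S.powerset.filter fun x => 4 * (x ∩ I).card ≤ I.card).card : ℝ)
      = ∑ x ∈ S.powerset.filter (fun x => 4 * (x ∩ I).card ≤ I.card), 1 := by simp
    _ ≤ ∑ x ∈ S.powerset.filter (fun x => 4 * (x ∩ I).card ≤ I.card),
          (3 / 2 : ℝ) ^ I.card * (16 / 81) ^ (x ∩ I).card := by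
        refine Finset.sum_le_sum fun x hx => ?_
        have hx := (Finset.mem_filter.1 hx).2
        -- `16 / 81 = (2 / 3) ^ 4` matches the threshold of a quarter of `I`.
        have : (16 / 81 : ℝ) ^ (x ∩ I).card = ((3 / 2 : ℝ) ^ (4 * (x ∩ I).card))⁻¹ := by
          rw [pow_mul, ← inv_pow]
          norm_num
        rw [this, ← div_eq_mul_inv, le_div_iff₀ (by positivity), one_mul]
        exact pow_le_pow_right₀ (by norm_num) hx
    _ ≤ ∑ x ∈ S.powerset, (3 / 2 : ℝ) ^ I.card * (16 / 81) ^ (x ∩ I).card :=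
        Finset.sum_le_sum_of_subset_of_nonneg (Finset.filter_subset _ _)
          fun _ _ _ => by positivity
    _ = 2 ^ S.card * (97 / 108) ^ I.card := by
        rw [← Finset.mul_sum, hsum]
        obtain ⟨m, hm⟩ := Nat.exists_eq_add_of_le hcard
        rw [hm, Nat.add_sub_cancel_left, pow_add]
        have : (97 / 108 : ℝ) ^ I.card * 2 ^ I.card = (3 / 2) ^ I.card * (97 / 81) ^ I.card := by
          rw [← mul_pow, ← mul_pow]
          norm_num
        linear_combination (-(2 : ℝ) ^ m) * this

section Balance

variable {V : Type*} [DecidableEq V]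

/-- The elements of `S` that too few members of the family `F` contain, up to the additive error
`4 ^ l * 0.98 ^ l`. -/
noncomputable def rareElements (l : ℕ) (F : Finset (Finset V)) (S : Finset V) : Finset V :=
  S.filter fun i => ((F.filter fun x => i ∈ x).card : ℝ) <
    ((F.filter fun x => i ∉ x).card : ℝ) / 8 - 4 ^ l * (98 / 100) ^ l

/-- A family of subsets of a `2 l`-element set has few rare elements: otherwise a typical member
would avoid most of them, and by the exponential moment bound the family would be too small for
the additive error. -/
lemma four_mul_card_rareElements_le (l : ℕ) (F : Finset (Finset V)) (S : Finset V)
    (hS : S.card = 2 * l) (hF : ∀ x ∈ F, x ⊆ S) :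
    4 * (rareElements l F S).card ≤ l := by
  by_contra! hcon
  set I := rareElements l F S with hI
  have hIS : I ⊆ S := Finset.filter_subset _ _
  have hbad : ∀ i ∈ I, ((F.filter fun x => i ∈ x).card : ℝ) <
      ((F.filter fun x => i ∉ x).card : ℝ) / 8 - 4 ^ l * (98 / 100) ^ l :=
    fun i hi => (Finset.mem_filter.1 hi).2
  have hle : ∀ i, ((F.filter fun x => i ∉ x).card : ℝ) ≤ F.card := fun i => by
    exact_mod_cast Finset.card_filter_le _ _
  have hpos : (0 : ℝ) < 4 ^ l * (98 / 100) ^ l := by positivity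
  have hIne : I.Nonempty := Finset.card_pos.1 (by omega)
  -- The family is large, as witnessed by any rare element.
  have hlarge : 8 * (4 ^ l * (98 / 100) ^ l : ℝ) < F.card := by
    obtain ⟨i, hi⟩ := hIne
    have h1 := hbad i hi
    have h2 := hle i
    have h3 : (0 : ℝ) ≤ (F.filter fun x => i ∈ x).card := by positivity
    linarith
  -- Double counting: on average a member of `F` contains at most an eighth of `I`.
  have hdc : ∑ x ∈ F, ((x ∩ I).card : ℝ) ≤ (I.card : ℝ) * (F.card / 8) := by
    have : ∑ x ∈ F, ((x ∩ I).card : ℝ) = ∑ i ∈ I, ((F.filter fun x => i ∈ x).card : ℝ) := by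
      have h := Finset.sum_card_bipartiteAbove_eq_sum_card_bipartiteBelow
        (s := F) (t := I) (fun x i => i ∈ x)
      simp only [Finset.bipartiteAbove, Finset.bipartiteBelow] at h
      have h' : ∀ x : Finset V, x ∩ I = I.filter fun i => i ∈ x := fun x => by
        ext i; simp [and_comm]
      simp only [h']
      exact_mod_cast h
    rw [this, ← nsmul_eq_mul]
    refine Finset.sum_le_card_nsmul _ _ _ fun i hi => ?_
    have h1 := hbad i hi
    have h2 := hle i
    linarith
  -- Markov: half of `F` contains at most a quarter of `I`.
  have hmarkov : (F.card : ℝ) ≤ 2 * (F.filter fun x => 4 * (x ∩ I).card ≤ I.card).card := by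
    have hsplit := Finset.card_filter_add_card_filter_not (s := F)
      (fun x => 4 * (x ∩ I).card ≤ I.card)
    have h1 : ((F.filter fun x => ¬ 4 * (x ∩ I).card ≤ I.card).card : ℝ) * (I.card / 4) ≤
        ∑ x ∈ F, ((x ∩ I).card : ℝ) := by
      rw [← nsmul_eq_mul]
      refine (Finset.card_nsmul_le_sum _ _ _ fun x hx => ?_).trans
        (Finset.sum_le_sum_of_subset_of_nonneg (Finset.filter_subset _ _)
          fun _ _ _ => by positivity)
      have := (Finset.mem_filter.1 hx).2
      have : (I.card : ℝ) ≤ 4 * (x ∩ I).card := by exact_mod_cast (not_le.1 this).le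
      linarith
    have hIpos : (0 : ℝ) < I.card := by exact_mod_cast hIne.card_pos
    have h2 : ((F.filter fun x => ¬ 4 * (x ∩ I).card ≤ I.card).card : ℝ) ≤ F.card / 2 := by
      have := h1.trans hdc
      have h3 : (I.card : ℝ) * ((F.filter fun x => ¬ 4 * (x ∩ I).card ≤ I.card).card) ≤
        I.card * (F.card / 2) := by linarith
      exact le_of_mul_le_mul_left h3 hIpos
    have h3 : ((F.filter fun x => 4 * (x ∩ I).card ≤ I.card).card : ℝ) +
      (F.filter fun x => ¬ 4 * (x ∩ I).card ≤ I.card).card = F.card := by exact_mod_cast hsplit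
    linarith
  have htail : ((F.filter fun x => 4 * (x ∩ I).card ≤ I.card).card : ℝ) ≤
      4 ^ l * (98 / 100) ^ l := by
    have h1 : ((F.filter fun x => 4 * (x ∩ I).card ≤ I.card).card : ℝ) ≤
        (S.powerset.filter fun x => 4 * (x ∩ I).card ≤ I.card).card := by
      refine Nat.cast_le.2 (Finset.card_le_card (Finset.filter_subset_filter _ fun x hx => ?_))
      exact Finset.mem_powerset.2 (hF x hx)
    refine (h1.trans (card_filter_inter_small_le hIS)).trans ?_
    rw [hS, pow_mul]
    norm_num only
    refine mul_le_mul_of_nonneg_left ?_ (by positivity)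
    calc (97 / 108 : ℝ) ^ I.card ≤ ((49 / 50 : ℝ) ^ 4) ^ I.card :=
          pow_le_pow_left₀ (by norm_num) (by norm_num) _
      _ = (49 / 50 : ℝ) ^ (4 * I.card) := by rw [pow_mul]
      _ ≤ (49 / 50 : ℝ) ^ l := pow_le_pow_of_le_one (by norm_num) (by norm_num) hcon.le
  linarith

/-- Rare elements carry at most a quarter of the pairs of a member of `F` and an element of `S`
outside it. -/
lemma sum_rareElements_le (l : ℕ) (F : Finset (Finset V)) (S : Finset V)
    (hS : S.card = 2 * l) (hF : ∀ x ∈ F, x ⊆ S ∧ x.card = l) :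
    ∑ i ∈ S, (if i ∈ rareElements l F S then ((F.filter fun x => i ∉ x).card : ℝ) else 0) ≤
      1 / 4 * ∑ i ∈ S, ((F.filter fun x => i ∉ x).card : ℝ) := by
  have htot : ∑ i ∈ S, ((F.filter fun x => i ∉ x).card : ℝ) = l * F.card := by
    have h := Finset.sum_card_bipartiteAbove_eq_sum_card_bipartiteBelow
      (s := F) (t := S) (fun x i => i ∉ x)
    simp only [Finset.bipartiteAbove, Finset.bipartiteBelow] at h
    have h' : ∀ x ∈ F, (S.filter fun i => i ∉ x).card = l := fun x hx => by
      rw [Finset.filter_notMem_eq_sdiff, Finset.card_sdiff_of_subset (hF x hx).1, hS, (hF x hx).2]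
      omega
    rw [Finset.sum_congr rfl h', Finset.sum_const, smul_eq_mul, mul_comm] at h
    exact_mod_cast h.symm
  rw [htot, ← Finset.sum_filter]
  have h1 : ∑ i ∈ S.filter (fun i => i ∈ rareElements l F S),
      ((F.filter fun x => i ∉ x).card : ℝ) ≤
      (S.filter (fun i => i ∈ rareElements l F S)).card • (F.card : ℝ) :=
    Finset.sum_le_card_nsmul _ _ _ fun i _ => by exact_mod_cast Finset.card_filter_le _ _
  have h2 : (S.filter (fun i => i ∈ rareElements l F S)).card ≤ (rareElements l F S).card :=
    Finset.card_le_card fun i hi => (Finset.mem_filter.1 hi).2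
  have h3 := four_mul_card_rareElements_le l F S hS fun x hx => (hF x hx).1
  have h4 : (4 * (S.filter (fun i => i ∈ rareElements l F S)).card : ℝ) ≤ l := by
    exact_mod_cast (by omega)
  rw [nsmul_eq_mul] at h1
  have h5 := mul_le_mul_of_nonneg_right h4 (Nat.cast_nonneg (α := ℝ) F.card)
  linarith

end Balance

/-! ### Razborov's double counting -/

lemma card_filter_powersetCard_between {V : Type*} [Fintype V] [DecidableEq V] {x W : Finset V}
    {c : ℕ} (hxW : x ⊆ W) (hc : x.card ≤ c) :
    (((Finset.univ : Finset V).powersetCard c).filter fun T => x ⊆ T ∧ T ⊆ W).card =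
      (W.card - x.card).choose (c - x.card) := by
  rw [← Finset.card_sdiff_of_subset hxW, ← Finset.card_powersetCard]
  refine Finset.card_bij' (fun T _ => T \ x) (fun U _ => U ∪ x) ?_ ?_ ?_ ?_
  · intro T hT
    simp only [Finset.mem_filter, Finset.mem_powersetCard_univ] at hT
    rw [Finset.mem_powersetCard]
    exact ⟨Finset.sdiff_subset_sdiff hT.2.2 le_rfl,
      by rw [Finset.card_sdiff_of_subset hT.2.1, hT.1]⟩
  · intro U hU
    rw [Finset.mem_powersetCard] at hU
    have hd : Disjoint U x := Finset.disjoint_of_subset_left hU.1 Finset.sdiff_disjoint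
    simp only [Finset.mem_filter, Finset.mem_powersetCard_univ]
    refine ⟨by rw [Finset.card_union_of_disjoint hd, hU.2]; omega, Finset.subset_union_right,
      Finset.union_subset (hU.1.trans Finset.sdiff_subset) hxW⟩
  · intro T hT
    simp only [Finset.mem_filter] at hT
    exact Finset.sdiff_union_of_subset hT.2.1
  · intro U hU
    rw [Finset.mem_powersetCard] at hU
    exact Finset.union_sdiff_cancel_right
      (Finset.disjoint_of_subset_left hU.1 Finset.sdiff_disjoint)

section Counts

variable {V : Type*} [DecidableEq V]

/-- The number of members of `F` contained in `S` and containing `i`. -/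
def countWith (F : Finset (Finset V)) (S : Finset V) (i : V) : ℕ :=
  ((F.filter fun x => x ⊆ S).filter fun x => i ∈ x).card

/-- The number of members of `F` contained in `S` and not containing `i`. -/
def countWithout (F : Finset (Finset V)) (S : Finset V) (i : V) : ℕ :=
  ((F.filter fun x => x ⊆ S).filter fun x => i ∉ x).card

lemma countWithout_le {l : ℕ} {F : Finset (Finset V)} (hF : ∀ x ∈ F, x.card = l) {S : Finset V}
    {i : V} (hS : S.card = 2 * l) (hi : i ∈ S) : countWithout F S i ≤ (2 * l - 1).choose l := by
  have : (S.erase i).card = 2 * l - 1 := by rw [Finset.card_erase_of_mem hi, hS]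
  rw [← this, ← Finset.card_powersetCard]
  refine Finset.card_le_card fun x hx => ?_
  simp only [Finset.mem_filter] at hx
  exact Finset.mem_powersetCard.2 ⟨Finset.subset_erase.2 ⟨hx.1.2, hx.2⟩, hF x hx.1.1⟩

end Counts

section Corruption

variable {V : Type*} [Fintype V] [DecidableEq V]

/-- Sum over all ways to split the ground set into a set `T` of `2 l - 1` elements, one
element `i`, and the remaining elements. -/
def splitSum (l : ℕ) (f : Finset V → V → ℝ) : ℝ :=
  ∑ T ∈ (Finset.univ : Finset V).powersetCard (2 * l - 1), ∑ i ∈ Tᶜ, f T i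

lemma splitSum_mono {l : ℕ} {f g : Finset V → V → ℝ}
    (h : ∀ T i, T.card = 2 * l - 1 → i ∉ T → f T i ≤ g T i) : splitSum l f ≤ splitSum l g := by
  refine Finset.sum_le_sum fun T hT => Finset.sum_le_sum fun i hi => h T i ?_ ?_
  · exact Finset.mem_powersetCard_univ.1 hT
  · exact Finset.mem_compl.1 hi

lemma splitSum_congr {l : ℕ} {f g : Finset V → V → ℝ}
    (h : ∀ T i, T.card = 2 * l - 1 → i ∉ T → f T i = g T i) : splitSum l f = splitSum l g :=
  le_antisymm (splitSum_mono fun T i h1 h2 => (h T i h1 h2).le)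
    (splitSum_mono fun T i h1 h2 => (h T i h1 h2).ge)

/-- The sum over splittings, organized by the set `insert i T` of `2 l` elements. -/
lemma splitSum_eq_sum_insert {l : ℕ} (hl : 0 < l) (g : Finset V → V → ℝ) :
    splitSum l (fun T i => g (insert i T) i) =
      ∑ S ∈ (Finset.univ : Finset V).powersetCard (2 * l), ∑ i ∈ S, g S i := by
  unfold splitSum
  rw [Finset.sum_sigma', Finset.sum_sigma']
  refine Finset.sum_bij' (fun p _ => ⟨insert p.2 p.1, p.2⟩) (fun p _ => ⟨p.1.erase p.2, p.2⟩)
    ?_ ?_ ?_ ?_ ?_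
  · rintro ⟨T, i⟩ h
    simp only [Finset.mem_sigma, Finset.mem_powersetCard_univ, Finset.mem_compl] at h ⊢
    exact ⟨by rw [Finset.card_insert_of_notMem h.2, h.1]; omega, Finset.mem_insert_self _ _⟩
  · rintro ⟨S, i⟩ h
    simp only [Finset.mem_sigma, Finset.mem_powersetCard_univ, Finset.mem_compl] at h ⊢
    exact ⟨by rw [Finset.card_erase_of_mem h.2, h.1], Finset.notMem_erase _ _⟩
  · rintro ⟨T, i⟩ h
    simp only [Finset.mem_sigma, Finset.mem_compl] at h
    simp [Finset.erase_insert h.2]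
  · rintro ⟨S, i⟩ h
    simp only [Finset.mem_sigma] at h
    simp [Finset.insert_erase h.2]
  · rintro ⟨T, i⟩ _
    rfl

/-- Every disjoint pair arises, as `x ⊆ T` and `y ⊆ Tᶜ \ {i}`, from the same number of
splittings. -/
lemma splitSum_countWithout {l : ℕ} (hV : Fintype.card V + 1 = 4 * l) {A B : Finset (Finset V)}
    (hA : ∀ x ∈ A, x.card = l) (hB : ∀ y ∈ B, y.card = l) :
    splitSum l (fun T i => (countWithout A (insert i T) i : ℝ) * countWithout B Tᶜ i) =
      (l * (2 * l - 1).choose (l - 1) : ℕ) *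
        (((A ×ˢ B).filter fun p => (p.1 ∩ p.2).card = 0).card : ℝ) := by
  have h1 : splitSum l (fun T i => (countWithout A (insert i T) i : ℝ) * countWithout B Tᶜ i) =
      splitSum l (fun T i => ∑ p ∈ A ×ˢ B,
        if p.1 ⊆ T ∧ T ⊆ p.2ᶜ ∧ i ∉ p.2 then (1 : ℝ) else 0) := by
    refine splitSum_congr fun T i _ hi => ?_
    rw [← Nat.cast_mul, countWithout, countWithout, Finset.filter_filter, Finset.filter_filter,
      ← Finset.card_product, Finset.sum_boole]
    congr 2
    ext ⟨x, y⟩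
    simp only [Finset.mem_product, Finset.mem_filter]
    have e1 : (x ⊆ insert i T ∧ i ∉ x) ↔ (x ⊆ T ∧ i ∉ x) :=
      ⟨fun h => ⟨(Finset.subset_insert_iff_of_notMem h.2).1 h.1, h.2⟩,
        fun h => ⟨h.1.trans (Finset.subset_insert _ _), h.2⟩⟩
    have e2 : x ⊆ T → i ∉ x := fun h h' => hi (h h')
    have e3 : y ⊆ Tᶜ ↔ T ⊆ yᶜ := by
      rw [Finset.subset_compl_comm]
    rw [e1, e3]
    tauto
  rw [h1]
  have h2 : splitSum l (fun T i => ∑ p ∈ A ×ˢ B,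
        if p.1 ⊆ T ∧ T ⊆ p.2ᶜ ∧ i ∉ p.2 then (1 : ℝ) else 0) =
      ∑ p ∈ A ×ˢ B, splitSum l fun T i =>
        if p.1 ⊆ T ∧ T ⊆ p.2ᶜ ∧ i ∉ p.2 then (1 : ℝ) else 0 := by
    unfold splitSum
    rw [Finset.sum_comm (s := A ×ˢ B)]
    exact Finset.sum_congr rfl fun T _ => Finset.sum_comm
  rw [h2, Finset.card_filter, Nat.cast_sum, Finset.mul_sum]
  refine Finset.sum_congr rfl fun p hp => ?_
  obtain ⟨x, y⟩ := p
  have hx := hA x (Finset.mem_product.1 hp).1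
  have hy := hB y (Finset.mem_product.1 hp).2
  have h3 : splitSum l (fun T i => if x ⊆ T ∧ T ⊆ yᶜ ∧ i ∉ y then (1 : ℝ) else 0) =
      ∑ T ∈ ((Finset.univ : Finset V).powersetCard (2 * l - 1)).filter
        (fun T => x ⊆ T ∧ T ⊆ yᶜ), (l : ℝ) := by
    unfold splitSum
    rw [Finset.sum_filter]
    refine Finset.sum_congr rfl fun T hT => ?_
    have hT := Finset.mem_powersetCard_univ.1 hT
    split_ifs with h
    · have : ∀ i ∈ Tᶜ, (if x ⊆ T ∧ T ⊆ yᶜ ∧ i ∉ y then (1 : ℝ) else 0) =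
          if i ∉ y then 1 else 0 := fun i _ => by simp [h]
      rw [Finset.sum_congr rfl this, Finset.sum_boole, Finset.filter_notMem_eq_sdiff,
        Finset.card_sdiff_of_subset (Finset.subset_compl_comm.1 h.2), Finset.card_compl, hT, hy]
      congr 1
      omega
    · refine Finset.sum_eq_zero fun i _ => if_neg fun h' => h ⟨h'.1, h'.2.1⟩
  dsimp only
  rw [h3, Finset.sum_const, nsmul_eq_mul]
  by_cases hd : (x ∩ y).card = 0
  · have hsub : x ⊆ yᶜ := by
      rw [Finset.subset_compl_iff_disjoint_right, Finset.disjoint_iff_inter_eq_empty]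
      exact Finset.card_eq_zero.1 hd
    rw [card_filter_powersetCard_between hsub (by omega), Finset.card_compl, hx, hy, if_pos hd]
    have e1 : Fintype.card V - l - l = 2 * l - 1 := by omega
    have e2 : 2 * l - 1 - l = l - 1 := by omega
    rw [e1, e2]
    push_cast
    ring
  · rw [if_neg hd, Finset.card_eq_zero.2]
    · simp
    · refine Finset.filter_eq_empty_iff.2 fun T _ h => hd ?_
      rw [Finset.card_eq_zero, ← Finset.disjoint_iff_inter_eq_empty]
      exact Finset.subset_compl_iff_disjoint_right.1 (h.1.trans h.2)

/-- Every pair meeting in exactly one element arises, as `i ∈ x ⊆ insert i T` and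
`i ∈ y ⊆ Tᶜ`, from the same number of splittings. -/
lemma splitSum_countWith {l : ℕ} (hV : Fintype.card V + 1 = 4 * l) {A B : Finset (Finset V)}
    (hA : ∀ x ∈ A, x.card = l) (hB : ∀ y ∈ B, y.card = l) :
    splitSum l (fun T i => (countWith A (insert i T) i : ℝ) * countWith B Tᶜ i) =
      ((2 * l).choose l : ℕ) *
        (((A ×ˢ B).filter fun p => (p.1 ∩ p.2).card = 1).card : ℝ) := by
  have h1 : splitSum l (fun T i => (countWith A (insert i T) i : ℝ) * countWith B Tᶜ i) =
      splitSum l (fun T i => ∑ p ∈ A ×ˢ B,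
        if i ∈ p.1 ∧ p.1 ⊆ insert i T ∧ T ⊆ p.2ᶜ ∧ i ∈ p.2 then (1 : ℝ) else 0) := by
    refine splitSum_congr fun T i _ hi => ?_
    rw [← Nat.cast_mul, countWith, countWith, Finset.filter_filter, Finset.filter_filter,
      ← Finset.card_product, Finset.sum_boole]
    congr 2
    ext ⟨x, y⟩
    simp only [Finset.mem_product, Finset.mem_filter]
    have e3 : y ⊆ Tᶜ ↔ T ⊆ yᶜ := by
      rw [Finset.subset_compl_comm]
    rw [e3]
    tauto
  rw [h1]
  have h2 : splitSum l (fun T i => ∑ p ∈ A ×ˢ B,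
        if i ∈ p.1 ∧ p.1 ⊆ insert i T ∧ T ⊆ p.2ᶜ ∧ i ∈ p.2 then (1 : ℝ) else 0) =
      ∑ p ∈ A ×ˢ B, splitSum l fun T i =>
        if i ∈ p.1 ∧ p.1 ⊆ insert i T ∧ T ⊆ p.2ᶜ ∧ i ∈ p.2 then (1 : ℝ) else 0 := by
    unfold splitSum
    rw [Finset.sum_comm (s := A ×ˢ B)]
    exact Finset.sum_congr rfl fun T _ => Finset.sum_comm
  rw [h2, Finset.card_filter, Nat.cast_sum, Finset.mul_sum]
  refine Finset.sum_congr rfl fun p hp => ?_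
  obtain ⟨x, y⟩ := p
  have hx := hA x (Finset.mem_product.1 hp).1
  have hy := hB y (Finset.mem_product.1 hp).2
  dsimp only
  have hinter : ∀ (T : Finset V) (i : V), i ∈ x → x ⊆ insert i T → T ⊆ yᶜ → i ∈ y →
      x ∩ y = {i} := by
    intro T i hix hxT hTy hiy
    ext j
    simp only [Finset.mem_inter, Finset.mem_singleton]
    refine ⟨fun ⟨hj, hj'⟩ => ?_, fun h => h ▸ ⟨hix, hiy⟩⟩
    rcases Finset.mem_insert.1 (hxT hj) with h | h
    · exact h
    · exact absurd hj' (Finset.mem_compl.1 (hTy h))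
  by_cases hd : (x ∩ y).card = 1
  · rw [if_pos hd, Nat.cast_one, mul_one]
    obtain ⟨z, hz⟩ := Finset.card_eq_one.1 hd
    have hzx : z ∈ x := (Finset.mem_inter.1 (hz ▸ Finset.mem_singleton_self z)).1
    have hzy : z ∈ y := (Finset.mem_inter.1 (hz ▸ Finset.mem_singleton_self z)).2
    have h3 : splitSum l (fun T i =>
        if i ∈ x ∧ x ⊆ insert i T ∧ T ⊆ yᶜ ∧ i ∈ y then (1 : ℝ) else 0) =
        ∑ T ∈ ((Finset.univ : Finset V).powersetCard (2 * l - 1)).filter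
          (fun T => x.erase z ⊆ T ∧ T ⊆ yᶜ), (1 : ℝ) := by
      unfold splitSum
      rw [Finset.sum_filter]
      refine Finset.sum_congr rfl fun T _ => ?_
      split_ifs with h
      · have hzT : z ∈ Tᶜ := Finset.mem_compl.2 fun h' => Finset.mem_compl.1 (h.2 h') hzy
        rw [Finset.sum_eq_single_of_mem z hzT]
        · exact if_pos ⟨hzx, Finset.subset_insert_iff.2 h.1, h.2, hzy⟩
        · refine fun i _ hne => if_neg fun h' => hne ?_
          have := hinter T i h'.1 h'.2.1 h'.2.2.1 h'.2.2.2
          rw [hz] at this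
          exact (Finset.singleton_injective this).symm
      · refine Finset.sum_eq_zero fun i _ => if_neg fun h' => h ⟨?_, h'.2.2.1⟩
        have := hinter T i h'.1 h'.2.1 h'.2.2.1 h'.2.2.2
        rw [hz] at this
        rw [Finset.singleton_injective this]
        exact Finset.subset_insert_iff.1 h'.2.1
    have hcx : (x.erase z).card = l - 1 := by rw [Finset.card_erase_of_mem hzx, hx]
    have hlpos : 0 < l := hx ▸ Finset.card_pos.2 ⟨z, hzx⟩
    have hsub : x.erase z ⊆ yᶜ := by
      intro j hj
      rw [Finset.mem_compl]
      intro hjy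
      have : j ∈ x ∩ y := Finset.mem_inter.2 ⟨Finset.mem_of_mem_erase hj, hjy⟩
      rw [hz, Finset.mem_singleton] at this
      exact Finset.ne_of_mem_erase hj this
    rw [h3, Finset.sum_const, nsmul_eq_mul, mul_one,
      card_filter_powersetCard_between hsub (by omega), Finset.card_compl, hcx, hy]
    have e1 : Fintype.card V - l - (l - 1) = 2 * l := by omega
    have e2 : 2 * l - 1 - (l - 1) = l := by omega
    rw [e1, e2]
  · rw [if_neg hd, Nat.cast_zero, mul_zero]
    refine Finset.sum_eq_zero fun T _ => Finset.sum_eq_zero fun i _ => if_neg fun h => hd ?_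
    rw [hinter T i h.1 h.2.1 h.2.2.1 h.2.2.2, Finset.card_singleton]

lemma countWithout_powersetCard {l : ℕ} {S : Finset V} {i : V} (hS : S.card = 2 * l)
    (hi : i ∈ S) :
    countWithout ((Finset.univ : Finset V).powersetCard l) S i = (2 * l - 1).choose l := by
  have : (S.erase i).card = 2 * l - 1 := by rw [Finset.card_erase_of_mem hi, hS]
  rw [← this, ← Finset.card_powersetCard]
  unfold countWithout
  congr 1
  ext x
  simp only [Finset.mem_filter, Finset.mem_powersetCard, Finset.subset_erase, Finset.subset_univ,
    true_and]
  tauto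

lemma countWith_powersetCard {l : ℕ} (hl : 0 < l) {S : Finset V} {i : V} (hS : S.card = 2 * l)
    (hi : i ∈ S) :
    countWith ((Finset.univ : Finset V).powersetCard l) S i = (2 * l - 1).choose l := by
  have h := card_filter_powersetCard_between (c := l) (Finset.singleton_subset_iff.2 hi)
    (by rw [Finset.card_singleton]; omega)
  rw [Finset.card_singleton, hS] at h
  rw [← Nat.choose_symm (by omega : l ≤ 2 * l - 1)]
  have e : 2 * l - 1 - l = l - 1 := by omega
  rw [e, ← h]
  unfold countWith
  rw [Finset.filter_filter]
  congr 1
  ext x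
  simp only [Finset.mem_filter, Finset.singleton_subset_iff]
  tauto

/-- The elementary estimate at one splitting: unless an element is rare for one of the families,
the number of pairs meeting in it is at least a constant fraction of the number of disjoint
pairs. -/
lemma mul_ge_of_not_rare {a₀ a₁ b₀ b₁ H Δ : ℝ} (ha₀ : 0 ≤ a₀) (ha₁ : 0 ≤ a₁) (hb₀ : 0 ≤ b₀)
    (hb₁ : 0 ≤ b₁) (haH : a₀ ≤ H) (hbH : b₀ ≤ H) (hΔ : 0 ≤ Δ) (p q : Prop) [Decidable p]
    [Decidable q] (hp : p ↔ a₁ < a₀ / 8 - Δ) (hq : q ↔ b₁ < b₀ / 8 - Δ) :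
    1 / 64 * (a₀ * b₀ - (if p then a₀ else 0) * b₀ - a₀ * (if q then b₀ else 0)) -
      1 / 4 * Δ * H ≤ a₁ * b₁ := by
  have h1 := mul_nonneg ha₁ hb₁
  have h2 : 0 ≤ Δ * H := mul_nonneg hΔ (ha₀.trans haH)
  have h3 := mul_nonneg ha₀ hb₀
  have h4 := mul_le_mul_of_nonneg_left haH hΔ
  have h5 := mul_le_mul_of_nonneg_left hbH hΔ
  have h6 := mul_nonneg hΔ ha₀
  have h7 := mul_nonneg hΔ hb₀
  split_ifs with h h' h'
  · linarith
  · linarith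
  · linarith
  · rw [hp, not_lt] at h
    rw [hq, not_lt] at h'
    by_cases hs : a₀ / 8 - Δ ≤ 0
    · have := mul_le_mul_of_nonneg_right hs hb₀
      linarith
    · by_cases hs' : b₀ / 8 - Δ ≤ 0
      · have := mul_le_mul_of_nonneg_left hs' ha₀
        linarith
      · push Not at hs hs'
        have := mul_le_mul h h' hs'.le ha₁
        have := mul_nonneg hΔ hΔ
        linarith

/-- Pairs of sets in `A × B` meeting in one element are not much rarer than disjoint pairs,
in a form that counts each pair once for every splitting of the ground set it arises from. -/
lemma splitSum_corruption {l : ℕ} (hl : 0 < l) (hV : Fintype.card V + 1 = 4 * l)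
    {A B : Finset (Finset V)} (hA : ∀ x ∈ A, x.card = l) (hB : ∀ y ∈ B, y.card = l) :
    1 / 128 * splitSum l
        (fun T i => (countWithout A (insert i T) i : ℝ) * countWithout B Tᶜ i) -
      1 / 4 * (4 ^ l * (98 / 100) ^ l) * (2 * l - 1).choose l *
        splitSum (V := V) l (fun _ _ => 1) ≤
      splitSum l (fun T i => (countWith A (insert i T) i : ℝ) * countWith B Tᶜ i) := by
  set Δ : ℝ := 4 ^ l * (98 / 100) ^ l with hΔ
  have hΔ0 : 0 ≤ Δ := by positivity
  -- The contribution of splittings whose element is rare for `A`, respectively for `B`.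
  set badA : Finset V → V → ℝ := fun S i =>
    if i ∈ rareElements l (A.filter fun x => x ⊆ S) S then (countWithout A S i : ℝ) else 0
    with hbadA
  set badB : Finset V → V → ℝ := fun S i =>
    if i ∈ rareElements l (B.filter fun x => x ⊆ S) S then (countWithout B S i : ℝ) else 0
    with hbadB
  have hcompl : ∀ T : Finset V, T.card = 2 * l - 1 → Tᶜ.card = 2 * l := fun T hT => by
    rw [Finset.card_compl, hT]; omega
  have hpt := splitSum_mono (l := l)
    (f := fun T i => 1 / 64 * ((countWithout A (insert i T) i : ℝ) * countWithout B Tᶜ i -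
      badA (insert i T) i * countWithout B Tᶜ i - countWithout A (insert i T) i * badB Tᶜ i) -
      1 / 4 * Δ * (2 * l - 1).choose l)
    (g := fun T i => (countWith A (insert i T) i : ℝ) * countWith B Tᶜ i) (by
      intro T i hT hi
      have hS : (insert i T).card = 2 * l := by rw [Finset.card_insert_of_notMem hi, hT]; omega
      have hi' : i ∈ insert i T := Finset.mem_insert_self _ _
      have hi'' : i ∈ Tᶜ := Finset.mem_compl.2 hi
      exact mul_ge_of_not_rare (Nat.cast_nonneg _) (Nat.cast_nonneg _) (Nat.cast_nonneg _)
        (Nat.cast_nonneg _) (Nat.cast_le.2 (countWithout_le hA hS hi'))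
        (Nat.cast_le.2 (countWithout_le hB (hcompl T hT) hi'')) hΔ0 _ _
        (by simp [rareElements, countWith, countWithout, hΔ])
        (by simp [rareElements, countWith, countWithout, hΔ, hi]))
  have hlin : splitSum l (fun T i => 1 / 64 * ((countWithout A (insert i T) i : ℝ) *
      countWithout B Tᶜ i - badA (insert i T) i * countWithout B Tᶜ i -
      countWithout A (insert i T) i * badB Tᶜ i) - 1 / 4 * Δ * (2 * l - 1).choose l) =
      1 / 64 * (splitSum l
        (fun T i => (countWithout A (insert i T) i : ℝ) * countWithout B Tᶜ i) -
      splitSum l (fun T i => badA (insert i T) i * countWithout B Tᶜ i) -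
      splitSum l (fun T i => countWithout A (insert i T) i * badB Tᶜ i)) -
      1 / 4 * Δ * (2 * l - 1).choose l * splitSum (V := V) l (fun _ _ => 1) := by
    unfold splitSum
    simp only [Finset.sum_sub_distrib, Finset.mul_sum, mul_sub, mul_one]
  -- With `T` fixed, the sets of `A` avoiding `i` in `insert i T` do not depend on `i`.
  have hA0 : ∀ T : Finset V, ∀ i ∉ T,
      countWithout A (insert i T) i = (A.filter fun x => x ⊆ T).card := by
    intro T i hi
    unfold countWithout
    rw [Finset.filter_filter]
    congr 1
    refine Finset.filter_congr fun x _ => ?_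
    exact ⟨fun h => (Finset.subset_insert_iff_of_notMem h.2).1 h.1,
      fun h => ⟨h.trans (Finset.subset_insert _ _), fun h' => hi (h h')⟩⟩
  have hsideB : splitSum l (fun T i => countWithout A (insert i T) i * badB Tᶜ i) ≤
      1 / 4 * splitSum l
        (fun T i => (countWithout A (insert i T) i : ℝ) * countWithout B Tᶜ i) := by
    unfold splitSum
    rw [Finset.mul_sum]
    refine Finset.sum_le_sum fun T hT => ?_
    have hT := Finset.mem_powersetCard_univ.1 hT
    have e1 : ∀ g : V → ℝ, ∑ i ∈ Tᶜ, (countWithout A (insert i T) i : ℝ) * g i =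
        (A.filter fun x => x ⊆ T).card * ∑ i ∈ Tᶜ, g i := by
      intro g
      rw [Finset.mul_sum]
      exact Finset.sum_congr rfl fun i hi => by rw [hA0 T i (Finset.mem_compl.1 hi)]
    rw [e1, e1]
    have := sum_rareElements_le l (B.filter fun x => x ⊆ Tᶜ) Tᶜ (hcompl T hT) fun x hx =>
      ⟨(Finset.mem_filter.1 hx).2, hB x (Finset.mem_filter.1 hx).1⟩
    have := mul_le_mul_of_nonneg_left this
      (Nat.cast_nonneg (α := ℝ) (A.filter fun x => x ⊆ T).card)
    refine this.trans (le_of_eq ?_)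
    simp only [countWithout]
    ring
  -- With `S = insert i T` fixed, the sets of `B` avoiding `i` in `Tᶜ` do not depend on `i`.
  have hB0 : ∀ T : Finset V, ∀ i ∉ T,
      countWithout B Tᶜ i = (B.filter fun x => x ⊆ (insert i T)ᶜ).card := by
    intro T i hi
    unfold countWithout
    rw [Finset.filter_filter]
    congr 1
    refine Finset.filter_congr fun x _ => ?_
    rw [Finset.compl_insert, Finset.subset_erase]
  have hsideA : splitSum l (fun T i => badA (insert i T) i * countWithout B Tᶜ i) ≤
      1 / 4 * splitSum l
        (fun T i => (countWithout A (insert i T) i : ℝ) * countWithout B Tᶜ i) := by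
    have e : ∀ g : Finset V → V → ℝ,
        splitSum l (fun T i => g (insert i T) i * countWithout B Tᶜ i) =
        ∑ S ∈ (Finset.univ : Finset V).powersetCard (2 * l),
          (B.filter fun x => x ⊆ Sᶜ).card * ∑ i ∈ S, g S i := by
      intro g
      refine ((splitSum_congr fun T i _ hi => by rw [hB0 T i hi]).trans
        (splitSum_eq_sum_insert hl
          fun S i => g S i * ((B.filter fun x => x ⊆ Sᶜ).card : ℝ))).trans ?_
      refine Finset.sum_congr rfl fun S _ => ?_
      rw [← Finset.sum_mul, mul_comm]
    rw [e badA, e (fun S i => (countWithout A S i : ℝ)), Finset.mul_sum]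
    refine Finset.sum_le_sum fun S hS => ?_
    have := sum_rareElements_le l (A.filter fun x => x ⊆ S) S
      (Finset.mem_powersetCard_univ.1 hS) fun x hx =>
      ⟨(Finset.mem_filter.1 hx).2, hA x (Finset.mem_filter.1 hx).1⟩
    have := mul_le_mul_of_nonneg_left this
      (Nat.cast_nonneg (α := ℝ) (B.filter fun x => x ⊆ Sᶜ).card)
    refine this.trans (le_of_eq ?_)
    simp only [countWithout]
    ring
  rw [hlin] at hpt
  linarith

/-- **Razborov's corruption bound.** In a product `A × B` of families of `l`-element subsets of a
set with `4 l - 1` elements, the density of the pairs meeting in one element is at least a constant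
fraction of the density of the disjoint pairs, up to an exponentially small error. -/
theorem disjointness_corruption {l : ℕ} (hl : 0 < l) (hV : Fintype.card V + 1 = 4 * l)
    {A B : Finset (Finset V)} (hA : ∀ x ∈ A, x.card = l) (hB : ∀ y ∈ B, y.card = l) {D : ℕ → ℝ}
    (hD : ∀ m, D m = (((Finset.univ : Finset V).powersetCard l ×ˢ
      (Finset.univ : Finset V).powersetCard l).filter fun p => (p.1 ∩ p.2).card = m).card) :
    1 / 128 * ((((A ×ˢ B).filter fun p => (p.1 ∩ p.2).card = 0).card : ℝ) / D 0) -
      l * (98 / 100) ^ l ≤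
      (((A ×ˢ B).filter fun p => (p.1 ∩ p.2).card = 1).card : ℝ) / D 1 := by
  set H : ℝ := (((2 * l - 1).choose l : ℕ) : ℝ) with hH
  set N : ℝ := splitSum (V := V) l (fun _ _ => 1) with hN
  have hU : ∀ x ∈ (Finset.univ : Finset V).powersetCard l, x.card = l := fun x hx =>
    Finset.mem_powersetCard_univ.1 hx
  have hHpos : 0 < H := by
    rw [hH]
    exact_mod_cast Nat.choose_pos (by omega)
  have hNpos : 0 < N := by
    rw [hN, splitSum]
    have hne : ((Finset.univ : Finset V).powersetCard (2 * l - 1)).Nonempty := by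
      rw [Finset.powersetCard_nonempty, Finset.card_univ]
      omega
    refine Finset.sum_pos (fun T hT => ?_) hne
    have hT := Finset.mem_powersetCard_univ.1 hT
    rw [Finset.sum_const, nsmul_eq_mul, mul_one, Finset.card_compl, hT]
    exact_mod_cast (by omega)
  have hcompl : ∀ T : Finset V, T.card = 2 * l - 1 → Tᶜ.card = 2 * l := fun T hT => by
    rw [Finset.card_compl, hT]; omega
  have hins : ∀ (T : Finset V) (i : V), T.card = 2 * l - 1 → i ∉ T →
      (insert i T).card = 2 * l := fun T i hT hi => by
    rw [Finset.card_insert_of_notMem hi, hT]; omega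
  -- For the full families, both sums over splittings have the same value.
  have htot0 : (l * (2 * l - 1).choose (l - 1) : ℕ) * D 0 = H * H * N := by
    rw [hD, ← splitSum_countWithout hV hU hU, splitSum_congr (g := fun _ _ => H * H * 1)]
    · simp only [hN, splitSum, Finset.mul_sum]
    · intro T i hT hi
      rw [countWithout_powersetCard (hins T i hT hi) (Finset.mem_insert_self _ _),
        countWithout_powersetCard (hcompl T hT) (Finset.mem_compl.2 hi), mul_one]
  have htot1 : ((2 * l).choose l : ℕ) * D 1 = H * H * N := by
    rw [hD, ← splitSum_countWith hV hU hU, splitSum_congr (g := fun _ _ => H * H * 1)]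
    · simp only [hN, splitSum, Finset.mul_sum]
    · intro T i hT hi
      rw [countWith_powersetCard hl (hins T i hT hi) (Finset.mem_insert_self _ _),
        countWith_powersetCard hl (hcompl T hT) (Finset.mem_compl.2 hi), mul_one]
  have hmain := splitSum_corruption hl hV hA hB
  rw [splitSum_countWithout hV hA hB, splitSum_countWith hV hA hB, ← hN, ← hH] at hmain
  have hpos : 0 < H * H * N := by positivity
  set K0 : ℝ := ((l * (2 * l - 1).choose (l - 1) : ℕ) : ℝ) with hK0
  set K1 : ℝ := (((2 * l).choose l : ℕ) : ℝ) with hK1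
  have hK0pos : K0 ≠ 0 := by
    rintro h
    rw [h, zero_mul] at htot0
    linarith
  have hK1pos : K1 ≠ 0 := by
    rintro h
    rw [h, zero_mul] at htot1
    linarith
  have hD0 : D 0 = H * H * N / K0 := by rw [← htot0]; field_simp
  have hD1 : D 1 = H * H * N / K1 := by rw [← htot1]; field_simp
  -- `H` is half a central binomial coefficient, hence at least `4 ^ l / (4 l)`.
  have hHl : (4 : ℝ) ^ l ≤ 4 * l * H := by
    have h1 := Nat.four_pow_le_two_mul_self_mul_centralBinom l hl
    have h2 : l.centralBinom = 2 * (2 * l - 1).choose l := by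
      obtain ⟨m, rfl⟩ := Nat.exists_eq_succ_of_ne_zero hl.ne'
      have := Nat.choose_symm_half m
      have e : 2 * (m + 1) - 1 = 2 * m + 1 := by omega
      rw [Nat.centralBinom_eq_two_mul_choose, Nat.succ_eq_add_one, e, Nat.mul_succ,
        Nat.choose_succ_succ, this]
      ring
    rw [h2] at h1
    have h3 : ((4 ^ l : ℕ) : ℝ) ≤ ((2 * l * (2 * (2 * l - 1).choose l) : ℕ) : ℝ) := by
      exact_mod_cast h1
    push_cast at h3
    rw [hH]
    linarith
  rw [hD0, hD1]
  have hdiv := div_le_div_of_nonneg_right hmain hpos.le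
  have e1 : ∀ c : ℝ, c / (H * H * N / K0) = K0 * c / (H * H * N) := fun c => by field_simp
  have e2 : ∀ c : ℝ, c / (H * H * N / K1) = K1 * c / (H * H * N) := fun c => by field_simp
  rw [e1, e2]
  rw [sub_div, mul_div_assoc] at hdiv
  refine le_trans ?_ hdiv
  refine sub_le_sub_left ?_ _
  have e3 : 1 / 4 * (4 ^ l * (98 / 100 : ℝ) ^ l) * H * N / (H * H * N) =
      4 ^ l / (4 * H) * (98 / 100 : ℝ) ^ l := by field_simp
  rw [e3]
  refine mul_le_mul_of_nonneg_right ?_ (by positivity)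
  rw [div_le_iff₀ (by positivity)]
  linarith

end Corruption

/-! ### Conditional laws of the hard distribution -/

lemma card_filter_powersetCard_inter {V : Type*} [Fintype V] [DecidableEq V] {y : Finset V}
    {l m : ℕ} (hm : m ≤ l) :
    (((Finset.univ : Finset V).powersetCard l).filter fun x => (x ∩ y).card = m).card =
      y.card.choose m * (Fintype.card V - y.card).choose (l - m) := by
  rw [← Finset.card_compl, ← Finset.card_powersetCard, ← Finset.card_powersetCard (l - m),
    ← Finset.card_product]
  refine Finset.card_bij' (fun x _ => (x ∩ y, x \ y)) (fun p _ => p.1 ∪ p.2) ?_ ?_ ?_ ?_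
  · intro x hx
    simp only [Finset.mem_filter, Finset.mem_powersetCard_univ] at hx
    simp only [Finset.mem_product, Finset.mem_powersetCard]
    refine ⟨⟨Finset.inter_subset_right, hx.2⟩, ?_, ?_⟩
    · intro j hj
      exact Finset.mem_compl.2 (Finset.mem_sdiff.1 hj).2
    · have := Finset.card_inter_add_card_sdiff x y
      omega
  · rintro ⟨u, v⟩ h
    simp only [Finset.mem_product, Finset.mem_powersetCard] at h
    obtain ⟨⟨hu, hum⟩, hv, hvm⟩ := h
    have hvy : Disjoint v y := Finset.subset_compl_iff_disjoint_right.1 hv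
    have hd : Disjoint u v := (Finset.disjoint_of_subset_right hu hvy).symm
    simp only [Finset.mem_filter, Finset.mem_powersetCard_univ]
    refine ⟨by rw [Finset.card_union_of_disjoint hd, hum, hvm]; omega, ?_⟩
    rw [Finset.union_inter_distrib_right, Finset.inter_eq_left.2 hu,
      Finset.disjoint_iff_inter_eq_empty.1 hvy, Finset.union_empty, hum]
  · intro x _
    ext j
    simp only [Finset.mem_union, Finset.mem_inter, Finset.mem_sdiff]
    tauto
  · rintro ⟨u, v⟩ h
    simp only [Finset.mem_product, Finset.mem_powersetCard] at h
    obtain ⟨⟨hu, -⟩, hv, -⟩ := h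
    ext j
    · have := @hu j
      have := @hv j
      simp only [Finset.mem_compl, Finset.mem_inter, Finset.mem_union] at *
      tauto
    · have := @hu j
      have := @hv j
      simp only [Finset.mem_compl, Finset.mem_sdiff, Finset.mem_union] at *
      tauto

/-- The number of `l`-element subsets of a set with `4 l - 1` elements that meet a fixed
`l`-element subset in exactly `m` elements. -/
def meetCount (l m : ℕ) : ℕ := l.choose m * (3 * l - 1).choose (l - m)

/-- The uniform law on the `l`-element sets that meet `y` in exactly `m` elements. -/
noncomputable def meetMass {r : ℕ} (l m : ℕ) (y x : Finset (Fin r)) : ℝ :=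
  if x.card = l ∧ (x ∩ y).card = m then 1 / (meetCount l m : ℝ) else 0

section MeetMass

variable {r l : ℕ}

lemma meetCount_pos {m : ℕ} (hl : 0 < l) (hm : m ≤ l) : 0 < meetCount l m :=
  Nat.mul_pos (Nat.choose_pos hm) (Nat.choose_pos (by omega))

lemma meetMass_nonneg (m : ℕ) (y x : Finset (Fin r)) : 0 ≤ meetMass l m y x := by
  unfold meetMass
  split_ifs <;> positivity

lemma card_filter_inter_eq_meetCount (hr : r + 1 = 4 * l) {m : ℕ} (hm : m ≤ l)
    {y : Finset (Fin r)} (hy : y.card = l) :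
    (((Finset.univ : Finset (Fin r)).powersetCard l).filter fun x => (x ∩ y).card = m).card =
      meetCount l m := by
  rw [card_filter_powersetCard_inter hm, hy, Fintype.card_fin, meetCount]
  congr 2
  omega

lemma sum_meetMass (hl : 0 < l) (hr : r + 1 = 4 * l) {m : ℕ} (hm : m ≤ l) {y : Finset (Fin r)}
    (hy : y.card = l) : ∑ x, meetMass l m y x = 1 := by
  have h := card_filter_inter_eq_meetCount hr hm hy
  have hpos : (meetCount l m : ℝ) ≠ 0 := by exact_mod_cast (meetCount_pos hl hm).ne'
  unfold meetMass
  rw [← Finset.sum_filter, Finset.sum_const, nsmul_eq_mul]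
  have e : (Finset.univ.filter fun x : Finset (Fin r) => x.card = l ∧ (x ∩ y).card = m) =
      ((Finset.univ : Finset (Fin r)).powersetCard l).filter fun x => (x ∩ y).card = m := by
    ext x
    simp [Finset.mem_powersetCard]
  rw [e, h]
  field_simp

/-- A set meeting `y` nowhere avoids a given element outside `y` with probability at most
`2 / 3`. -/
lemma sum_meetMass_zero_avoiding_le (hl : 0 < l) (hr : r + 1 = 4 * l) {y : Finset (Fin r)}
    (hy : y.card = l) {u : Fin r} (hu : u ∉ y) :
    ∑ x, (if u ∈ x then 0 else meetMass l 0 y x) ≤ 2 / 3 := by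
  have hcard : (insert u y)ᶜ.card = 3 * l - 2 := by
    rw [Finset.card_compl, Finset.card_insert_of_notMem hu, hy, Fintype.card_fin]
    omega
  have h1 : ∑ x, (if u ∈ x then 0 else meetMass l 0 y x) =
      ∑ x ∈ ((insert u y)ᶜ).powersetCard l, 1 / (meetCount l 0 : ℝ) := by
    unfold meetMass
    rw [← Finset.sum_subset (Finset.subset_univ (((insert u y)ᶜ).powersetCard l))]
    · refine Finset.sum_congr rfl fun x hx => ?_
      obtain ⟨h, hc⟩ := Finset.mem_powersetCard.1 hx
      have hux : u ∉ x := fun h' => Finset.mem_compl.1 (h h') (Finset.mem_insert_self _ _)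
      have hd : (x ∩ y).card = 0 := by
        rw [Finset.card_eq_zero, ← Finset.disjoint_iff_inter_eq_empty]
        refine Finset.disjoint_left.2 fun j hj hj' => ?_
        exact Finset.mem_compl.1 (h hj) (Finset.mem_insert_of_mem hj')
      simp [hux, hc, hd]
    · intro x _ hx
      by_cases hux : u ∈ x
      · simp [hux]
      · rw [if_neg hux, if_neg]
        rintro ⟨hc, hd⟩
        refine hx (Finset.mem_powersetCard.2 ⟨fun j hj => ?_, hc⟩)
        rw [Finset.mem_compl, Finset.mem_insert]
        rintro (rfl | h)
        · exact hux hj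
        · have := Finset.card_eq_zero.1 hd
          exact Finset.notMem_empty j (this ▸ Finset.mem_inter.2 ⟨hj, h⟩)
  rw [h1, Finset.sum_const, Finset.card_powersetCard, hcard, nsmul_eq_mul, mul_one_div]
  have hpos : (0 : ℝ) < meetCount l 0 := by exact_mod_cast meetCount_pos hl (Nat.zero_le _)
  rw [div_le_iff₀ hpos]
  have hchoose := Nat.choose_mul_succ_eq (3 * l - 2) l
  have e1 : 3 * l - 2 + 1 = 3 * l - 1 := by omega
  have e2 : 3 * l - 1 - l = 2 * l - 1 := by omega
  rw [e1, e2] at hchoose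
  have e3 : meetCount l 0 = (3 * l - 1).choose l := by simp [meetCount]
  have h3 : 3 * (3 * l - 2).choose l ≤ 2 * (3 * l - 1).choose l := by
    have hle : 3 * (2 * l - 1) ≤ 2 * (3 * l - 1) := by omega
    refine Nat.le_of_mul_le_mul_right (c := 3 * l - 1) ?_ (by omega)
    calc 3 * (3 * l - 2).choose l * (3 * l - 1)
        = (3 * l - 1).choose l * (3 * (2 * l - 1)) := by rw [mul_assoc, hchoose]; ring
      _ ≤ (3 * l - 1).choose l * (2 * (3 * l - 1)) := Nat.mul_le_mul_left _ hle
      _ = 2 * (3 * l - 1).choose l * (3 * l - 1) := by ring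
  have h4 : (3 * (3 * l - 2).choose l : ℝ) ≤ 2 * (3 * l - 1).choose l := by exact_mod_cast h3
  rw [e3]
  linarith

lemma card_product_filter_div_eq (m : ℕ) (A : Finset (Finset (Fin r)))
    {B : Finset (Finset (Fin r))} (hA : ∀ x ∈ A, x.card = l) :
    (((A ×ˢ B).filter fun p => (p.1 ∩ p.2).card = m).card : ℝ) /
      (r.choose l * meetCount l m : ℕ) =
      ∑ y ∈ B, 1 / (r.choose l : ℝ) * ∑ x ∈ A, meetMass l m y x := by
  rw [Finset.card_filter, Finset.sum_product_right, Nat.cast_sum, Finset.sum_div]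
  refine Finset.sum_congr rfl fun y _ => ?_
  rw [Nat.cast_sum, Finset.sum_div, Finset.mul_sum]
  refine Finset.sum_congr rfl fun x hx => ?_
  unfold meetMass
  by_cases h : (x ∩ y).card = m
  · simp only [h, hA x hx, and_self, if_true]
    push_cast
    rw [one_div_mul_one_div]
  · simp [h]

lemma card_product_filter_powersetCard (hr : r + 1 = 4 * l) {m : ℕ} (hm : m ≤ l) :
    ((((Finset.univ : Finset (Fin r)).powersetCard l ×ˢ
      (Finset.univ : Finset (Fin r)).powersetCard l).filter
        fun p => (p.1 ∩ p.2).card = m).card) = r.choose l * meetCount l m := by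
  rw [Finset.card_filter, Finset.sum_product_right]
  have : ∀ y ∈ (Finset.univ : Finset (Fin r)).powersetCard l,
      ∑ x ∈ (Finset.univ : Finset (Fin r)).powersetCard l,
        (if (x ∩ y).card = m then 1 else 0) = meetCount l m := fun y hy => by
    rw [← Finset.card_filter]
    exact card_filter_inter_eq_meetCount hr hm (Finset.mem_powersetCard_univ.1 hy)
  rw [Finset.sum_congr rfl this, Finset.sum_const, Finset.card_powersetCard, smul_eq_mul,
    Finset.card_univ, Fintype.card_fin]

lemma pairsMeetingIn_eq (hr : r + 1 = 4 * l) (m : ℕ) :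
    pairsMeetingIn r m = ((Finset.univ : Finset (Fin r)).powersetCard l ×ˢ
      (Finset.univ : Finset (Fin r)).powersetCard l).filter
        fun p => (p.1 ∩ p.2).card = m := by
  ext ⟨x, y⟩
  simp only [pairsMeetingIn, Finset.mem_filter, Finset.mem_univ, true_and, Finset.mem_product,
    Finset.mem_powersetCard_univ, hr]
  constructor
  · rintro ⟨h1, h2, h3⟩
    exact ⟨⟨by omega, by omega⟩, h3⟩
  · rintro ⟨⟨h1, h2⟩, h3⟩
    exact ⟨by omega, by omega, h3⟩

lemma uniformMass_pairsMeetingIn (hr : r + 1 = 4 * l) {m : ℕ} (hm : m ≤ l)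
    (x y : Finset (Fin r)) :
    uniformMass (pairsMeetingIn r m) (x, y) =
      if y.card = l then 1 / (r.choose l : ℝ) * meetMass l m y x else 0 := by
  unfold uniformMass meetMass
  rw [pairsMeetingIn_eq hr, card_product_filter_powersetCard hr hm]
  simp only [Finset.mem_filter, Finset.mem_product, Finset.mem_powersetCard_univ]
  by_cases hy : y.card = l <;> by_cases hx : x.card = l <;> by_cases h : (x ∩ y).card = m <;>
    simp [hx, hy, h, mul_comm]

lemma tau_eq (hl : 0 < l) (hr : r + 1 = 4 * l) (β : ℝ) (x y : Finset (Fin r)) :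
    tau r β (x, y) = if y.card = l then
      1 / (r.choose l : ℝ) * (β * meetMass l 1 y x + (1 - β) * meetMass l 0 y x) else 0 := by
  unfold tau
  rw [uniformMass_pairsMeetingIn hr hl, uniformMass_pairsMeetingIn hr (Nat.zero_le _)]
  split_ifs <;> ring

lemma sndMarginal_tau (hl : 0 < l) (hr : r + 1 = 4 * l) (β : ℝ) (y : Finset (Fin r)) :
    sndMarginal (tau r β) y = if y.card = l then 1 / (r.choose l : ℝ) else 0 := by
  unfold sndMarginal
  simp only [tau_eq hl hr]
  split_ifs with hy
  · rw [← Finset.mul_sum, Finset.sum_add_distrib, ← Finset.mul_sum, ← Finset.mul_sum,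
      sum_meetMass hl hr hl hy, sum_meetMass hl hr (Nat.zero_le _) hy]
    ring
  · simp

lemma nu_tau (hl : 0 < l) (hr : r + 1 = 4 * l) (k : ℕ) (β : ℝ) (x : Fin k → Finset (Fin r))
    (y : Finset (Fin r)) :
    nu k (tau r β) x y = if y.card = l then 1 / (r.choose l : ℝ) *
      ∏ i, (β * meetMass l 1 y (x i) + (1 - β) * meetMass l 0 y (x i)) else 0 := by
  unfold nu condMass
  simp only [sndMarginal_tau hl hr, tau_eq hl hr]
  have hpos : (r.choose l : ℝ) ≠ 0 := by exact_mod_cast (Nat.choose_pos (by omega)).ne'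
  split_ifs
  · congr 1
    refine Finset.prod_congr rfl fun i _ => ?_
    field_simp
  · simp

/-- The corruption bound with the second family replaced by weights in `[0, 1]`: both sides are
affine in the weights, so the extreme case is that of a family. -/
lemma meetMass_corruption (hl : 0 < l) (hr : r + 1 = 4 * l) (A : Finset (Finset (Fin r)))
    (ρ : Finset (Fin r) → ℝ) (hρ0 : ∀ y, y.card = l → 0 ≤ ρ y)
    (hρ1 : ∀ y, y.card = l → ρ y ≤ 1) :
    1 / 128 * ∑ y ∈ (Finset.univ : Finset (Fin r)).powersetCard l,
        1 / (r.choose l : ℝ) * ((∑ x ∈ A, meetMass l 0 y x) * ρ y) - l * (98 / 100) ^ l ≤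
      ∑ y ∈ (Finset.univ : Finset (Fin r)).powersetCard l,
        1 / (r.choose l : ℝ) * ((∑ x ∈ A, meetMass l 1 y x) * ρ y) := by
  set A' := A.filter fun x => x.card = l with hA'
  have hAA' : ∀ m y, ∑ x ∈ A, meetMass l m y x = ∑ x ∈ A', meetMass l m y x := by
    intro m y
    rw [hA', Finset.sum_filter]
    refine Finset.sum_congr rfl fun x _ => ?_
    unfold meetMass
    by_cases h : x.card = l <;> simp [h]
  simp only [hAA']
  set a : Finset (Fin r) → ℝ := fun y => 1 / (r.choose l : ℝ) * ∑ x ∈ A', meetMass l 1 y x -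
    1 / 128 * (1 / (r.choose l : ℝ) * ∑ x ∈ A', meetMass l 0 y x) with ha
  set B := ((Finset.univ : Finset (Fin r)).powersetCard l).filter fun y => a y < 0 with hB
  have hBl : ∀ y ∈ B, y.card = l := fun y hy =>
    Finset.mem_powersetCard_univ.1 (Finset.mem_filter.1 hy).1
  have hA'l : ∀ x ∈ A', x.card = l := fun x hx => (Finset.mem_filter.1 hx).2
  have h := disjointness_corruption hl (by rw [Fintype.card_fin]; exact hr) hA'l hBl
    (fun m => rfl)
  simp only [card_product_filter_powersetCard hr (Nat.zero_le l),
    card_product_filter_powersetCard hr hl, card_product_filter_div_eq _ _ hA'l] at h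
  have h2 : -(l * (98 / 100 : ℝ) ^ l) ≤ ∑ y ∈ B, a y := by
    rw [Finset.mul_sum] at h
    simp only [ha, Finset.sum_sub_distrib]
    linarith
  have h3 : ∑ y ∈ B, a y ≤ ∑ y ∈ (Finset.univ : Finset (Fin r)).powersetCard l, a y * ρ y := by
    rw [hB, Finset.sum_filter]
    refine Finset.sum_le_sum fun y hy => ?_
    have hy := Finset.mem_powersetCard_univ.1 hy
    have h0 := hρ0 y hy
    have h1 := hρ1 y hy
    split_ifs with hneg
    · have := mul_le_mul_of_nonneg_left h1 (neg_nonneg.2 hneg.le)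
      linarith
    · exact mul_nonneg (not_lt.1 hneg) h0
  have h4 : ∑ y ∈ (Finset.univ : Finset (Fin r)).powersetCard l, a y * ρ y =
      ∑ y ∈ (Finset.univ : Finset (Fin r)).powersetCard l,
        1 / (r.choose l : ℝ) * ((∑ x ∈ A', meetMass l 1 y x) * ρ y) -
      1 / 128 * ∑ y ∈ (Finset.univ : Finset (Fin r)).powersetCard l,
        1 / (r.choose l : ℝ) * ((∑ x ∈ A', meetMass l 0 y x) * ρ y) := by
    rw [Finset.mul_sum, ← Finset.sum_sub_distrib]
    refine Finset.sum_congr rfl fun y _ => ?_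
    rw [ha]
    ring
  linarith

end MeetMass

/-! ### The planted laws -/

/-- The set with the given characteristic vector. -/
def toSet {r : ℕ} (a : Fin r → Bool) : Finset (Fin r) := Finset.univ.filter fun j => a j = true

lemma toSet_injective {r : ℕ} : Function.Injective (toSet (r := r)) := by
  intro a b h
  funext j
  have : j ∈ toSet a ↔ j ∈ toSet b := by rw [h]
  simp only [toSet, Finset.mem_filter, Finset.mem_univ, true_and] at this
  exact Bool.eq_iff_iff.2 this

lemma sum_comp_toSet {r : ℕ} (g : Finset (Fin r) → ℝ) :
    ∑ a : Fin r → Bool, g (toSet a) = ∑ x, g x := by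
  refine Fintype.sum_bijective toSet ⟨toSet_injective, fun x => ⟨fun j => decide (j ∈ x), ?_⟩⟩
    _ _ fun _ => rfl
  ext j
  simp [toSet]

lemma sum_prod_apply {ι X : Type*} [Fintype ι] [DecidableEq ι] [Fintype X] (g : ι → X → ℝ) :
    ∑ x : ι → X, ∏ i, g i (x i) = ∏ i, ∑ a, g i a := by
  rw [Finset.prod_univ_sum, Fintype.piFinset_univ]

/-- The law of the inputs when a uniformly random set `y` of size `l` is chosen, the set of site
`i` meets `y` in exactly `p` elements, and the sets of the other sites are disjoint from `y`. -/
noncomputable def plantedLaw {k r : ℕ} (l : ℕ) (i : Fin k) (p : ℕ)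
    (x : Fin k → Fin r → Bool) : ℝ :=
  ∑ y ∈ (Finset.univ : Finset (Fin r)).powersetCard l, 1 / (r.choose l : ℝ) *
    ∏ j, meetMass l (if j = i then p else 0) y (toSet (x j))

section Planted

variable {k r l : ℕ}

lemma plantedLaw_nonneg (i : Fin k) (p : ℕ) (x : Fin k → Fin r → Bool) :
    0 ≤ plantedLaw l i p x :=
  Finset.sum_nonneg fun _ _ => mul_nonneg (by positivity)
    (Finset.prod_nonneg fun _ _ => meetMass_nonneg _ _ _)

lemma plantedLaw_zero_eq (i i' : Fin k) (x : Fin k → Fin r → Bool) :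
    plantedLaw l i 0 x = plantedLaw l i' 0 x := by
  simp [plantedLaw]

lemma sum_plantedLaw_zero (hl : 0 < l) (hr : r + 1 = 4 * l) (i : Fin k) :
    ∑ x : Fin k → Fin r → Bool, plantedLaw l i 0 x = 1 := by
  unfold plantedLaw
  rw [Finset.sum_comm]
  have h : ∀ y ∈ (Finset.univ : Finset (Fin r)).powersetCard l,
      ∑ x : Fin k → Fin r → Bool, 1 / (r.choose l : ℝ) *
        ∏ j, meetMass l (if j = i then 0 else 0) y (toSet (x j)) = 1 / (r.choose l : ℝ) := by
    intro y hy
    have hy := Finset.mem_powersetCard_univ.1 hy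
    rw [← Finset.mul_sum, sum_prod_apply
      (fun j a => meetMass l (if j = i then 0 else 0) y (toSet a))]
    have : ∀ j : Fin k, ∑ a : Fin r → Bool,
        meetMass l (if j = i then 0 else 0) y (toSet a) = 1 := fun j => by
      rw [sum_comp_toSet (fun x => meetMass l (if j = i then 0 else 0) y x), ite_self]
      exact sum_meetMass hl hr (Nat.zero_le _) hy
    rw [Finset.prod_congr rfl fun j _ => this j, Finset.prod_const_one, mul_one]
  have hpos : (r.choose l : ℝ) ≠ 0 := by exact_mod_cast (Nat.choose_pos (by omega)).ne'
  rw [Finset.sum_congr rfl h, Finset.sum_const, Finset.card_powersetCard, Finset.card_univ,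
    Fintype.card_fin, nsmul_eq_mul]
  field_simp

/-- The hard distribution dominates both planted laws, up to the factor `β` for the planted
intersection. -/
lemma zeta_ge_plantedLaw (hk : 2 ≤ k) (hl : 0 < l) (hr : r + 1 = 4 * l) (i : Fin k)
    (x : Fin k → Fin r → Bool) :
    1 / 2 * plantedLaw l i 0 x ≤ zeta k r x ∧
      1 / 2 * (1 / (k : ℝ) ^ 2) * plantedLaw l i 1 x ≤ zeta k r x := by
  set β : ℝ := 1 / (k : ℝ) ^ 2 with hβ
  have hk' : (2 : ℝ) ≤ k := by exact_mod_cast hk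
  have hkpos : (0 : ℝ) < k := by linarith
  have hβ0 : 0 ≤ β := by positivity
  have hβ1 : β ≤ 1 := by
    rw [hβ, div_le_one (by positivity)]
    nlinarith
  -- Bernoulli: all other sites are disjoint from `y` with probability at least one half.
  have hbern : (1 / 2 : ℝ) ≤ (1 - β) ^ k := by
    have h := one_add_mul_le_pow (a := -β) (by linarith) k
    have h2 : (k : ℝ) * β ≤ 1 / 2 := by
      rw [hβ, mul_one_div, div_le_iff₀ (by positivity)]
      nlinarith
    have h3 : 1 + (k : ℝ) * -β ≤ (1 - β) ^ k := by rw [sub_eq_add_neg]; exact h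
    linarith
  have hzeta : zeta k r x = ∑ y ∈ (Finset.univ : Finset (Fin r)).powersetCard l,
      1 / (r.choose l : ℝ) *
        ∏ j, (β * meetMass l 1 y (toSet (x j)) + (1 - β) * meetMass l 0 y (toSet (x j))) := by
    unfold zeta
    simp only [nu_tau hl hr]
    rw [← Finset.sum_filter]
    refine Finset.sum_congr ?_ fun _ _ => rfl
    ext y
    simp
  -- A lower bound on each factor of the product gives a lower bound on the law.
  have key : ∀ (c : ℝ) (p : ℕ) (w : Fin k → ℝ), (∀ j, 0 ≤ w j) → c ≤ ∏ j, w j →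
      (∀ j y, w j * meetMass l (if j = i then p else 0) y (toSet (x j)) ≤
        β * meetMass l 1 y (toSet (x j)) + (1 - β) * meetMass l 0 y (toSet (x j))) →
      c * plantedLaw l i p x ≤ zeta k r x := by
    intro c p w hw hc hle
    rw [hzeta, plantedLaw, Finset.mul_sum]
    refine Finset.sum_le_sum fun y _ => ?_
    rw [mul_left_comm]
    refine mul_le_mul_of_nonneg_left ?_ (by positivity)
    have h0 : ∀ j, 0 ≤ meetMass l (if j = i then p else 0) y (toSet (x j)) :=
      fun j => meetMass_nonneg _ _ _
    refine (mul_le_mul_of_nonneg_right hc (Finset.prod_nonneg fun j _ => h0 j)).trans ?_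
    rw [← Finset.prod_mul_distrib]
    exact Finset.prod_le_prod (fun j _ => mul_nonneg (hw j) (h0 j)) fun j _ => hle j y
  constructor
  · refine key _ 0 (fun _ => 1 - β) (fun _ => by linarith) (by simpa using hbern) ?_
    intro j y
    have := mul_nonneg hβ0 (meetMass_nonneg (l := l) 1 y (toSet (x j)))
    simpa using this
  · refine key _ 1 (fun j => if j = i then β else 1 - β) (fun j => ?_) ?_ ?_
    · split_ifs <;> linarith
    · rw [← Finset.mul_prod_erase Finset.univ _ (Finset.mem_univ i), if_pos rfl]
      have h1 : ∏ j ∈ Finset.univ.erase i, (if j = i then β else 1 - β) = (1 - β) ^ (k - 1) := by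
        rw [Finset.prod_congr rfl fun j hj => if_neg (Finset.ne_of_mem_erase hj),
          Finset.prod_const, Finset.card_erase_of_mem (Finset.mem_univ _), Finset.card_univ,
          Fintype.card_fin]
      rw [h1, mul_comm]
      refine mul_le_mul_of_nonneg_left (hbern.trans ?_) hβ0
      exact pow_le_pow_of_le_one (by linarith) (by linarith) (Nat.sub_le _ _)
    · intro j y
      have h1 := mul_nonneg hβ0 (meetMass_nonneg (l := l) 1 y (toSet (x j)))
      have h0 := mul_nonneg (sub_nonneg.2 hβ1) (meetMass_nonneg (l := l) 0 y (toSet (x j)))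
      split_ifs <;> linarith

/-! ### Values of the threshold function -/

lemma thresh_eq_card_biUnion (θ : ℕ) (x : Fin k → Fin r → Bool) :
    thresh θ x = decide (θ < (Finset.univ.biUnion fun i => toSet (x i)).card) := by
  unfold thresh
  congr 3
  ext j
  simp [toSet]

/-- If no set meets `y`, at most `3 l - 1` elements are covered. -/
lemma thresh_eq_false_of_plantedLaw_zero_ne_zero (hr : r + 1 = 4 * l) (i : Fin k)
    {x : Fin k → Fin r → Bool} (hx : plantedLaw l i 0 x ≠ 0) :
    thresh ((3 * r - 1) / 4) x = false := by
  obtain ⟨y, hy, hne⟩ := Finset.exists_ne_zero_of_sum_ne_zero hx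
  have hy := Finset.mem_powersetCard_univ.1 hy
  have hne := Finset.prod_ne_zero_iff.1 (mul_ne_zero_iff.1 hne).2
  rw [thresh_eq_card_biUnion, decide_eq_false_iff_not, not_lt]
  have hsub : (Finset.univ.biUnion fun i => toSet (x i)) ⊆ yᶜ := by
    refine Finset.biUnion_subset.2 fun j _ => ?_
    have h := hne j (Finset.mem_univ _)
    rw [ite_self, meetMass] at h
    have h := (ite_ne_right_iff.1 h).1.2
    rw [Finset.subset_compl_iff_disjoint_right, Finset.disjoint_iff_inter_eq_empty]
    exact Finset.card_eq_zero.1 h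
  refine (Finset.card_le_card hsub).trans ?_
  rw [Finset.card_compl, hy, Fintype.card_fin]
  omega

/-- With a planted intersection, the threshold is exceeded unless the other sets leave some
element outside `y` uncovered, which is unlikely. -/
lemma sum_plantedLaw_one_thresh_false_le (hl : 0 < l) (hr : r + 1 = 4 * l) (i : Fin k) :
    ∑ x : Fin k → Fin r → Bool,
      (if thresh ((3 * r - 1) / 4) x = false then plantedLaw l i 1 x else 0) ≤
      r * (2 / 3) ^ (k - 1) := by
  -- The factor of site `j` in the probability that `u` is missed by all sites but `i`.
  set g : Finset (Fin r) → Fin r → Fin k → (Fin r → Bool) → ℝ := fun y u j a =>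
    if j = i then meetMass l 1 y (toSet a)
    else if u ∈ toSet a then 0 else meetMass l 0 y (toSet a) with hg
  have hg0 : ∀ y u j a, 0 ≤ g y u j a := by
    intro y u j a
    simp only [hg]
    split_ifs
    · exact meetMass_nonneg _ _ _
    · exact le_rfl
    · exact meetMass_nonneg _ _ _
  have hpt : ∀ x : Fin k → Fin r → Bool,
      (if thresh ((3 * r - 1) / 4) x = false then plantedLaw l i 1 x else 0) ≤
      ∑ y ∈ (Finset.univ : Finset (Fin r)).powersetCard l, 1 / (r.choose l : ℝ) *
        ∑ u ∈ yᶜ, ∏ j, g y u j (x j) := by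
    intro x
    split_ifs with hf
    · refine Finset.sum_le_sum fun y hy => ?_
      have hy := Finset.mem_powersetCard_univ.1 hy
      refine mul_le_mul_of_nonneg_left ?_ (by positivity)
      have hnn : ∀ u ∈ yᶜ, 0 ≤ ∏ j, g y u j (x j) :=
        fun u _ => Finset.prod_nonneg fun j _ => hg0 _ _ _ _
      by_cases hz : ∏ j, meetMass l (if j = i then 1 else 0) y (toSet (x j)) = 0
      · rw [hz]
        exact Finset.sum_nonneg hnn
      · have hne := Finset.prod_ne_zero_iff.1 hz
        obtain ⟨u, huy, hu⟩ : ∃ u ∈ yᶜ, ∀ j, j ≠ i → u ∉ toSet (x j) := by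
          by_contra! hcon
          rw [thresh_eq_card_biUnion, decide_eq_false_iff_not, not_lt] at hf
          have h := hne i (Finset.mem_univ _)
          rw [if_pos rfl, meetMass] at h
          obtain ⟨z, hz⟩ := Finset.card_eq_one.1 (ite_ne_right_iff.1 h).1.2
          have hz' : z ∈ toSet (x i) ∩ y := hz ▸ Finset.mem_singleton_self z
          obtain ⟨hzx, hzy⟩ := Finset.mem_inter.1 hz'
          have hsub : insert z yᶜ ⊆ Finset.univ.biUnion fun i => toSet (x i) := by
            refine Finset.insert_subset (Finset.mem_biUnion.2 ⟨i, Finset.mem_univ _, hzx⟩) ?_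
            intro u hu
            obtain ⟨j, -, hj⟩ := hcon u hu
            exact Finset.mem_biUnion.2 ⟨j, Finset.mem_univ _, hj⟩
          have hc := Finset.card_le_card hsub
          rw [Finset.card_insert_of_notMem (fun h => Finset.mem_compl.1 h hzy),
            Finset.card_compl, hy, Fintype.card_fin] at hc
          omega
        refine le_trans (le_of_eq ?_) (Finset.single_le_sum hnn huy)
        refine Finset.prod_congr rfl fun j _ => ?_
        by_cases hj : j = i
        · simp [hg, hj]
        · simp [hg, hj, hu j hj]
    · exact Finset.sum_nonneg fun y _ => mul_nonneg (by positivity)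
        (Finset.sum_nonneg fun u _ => Finset.prod_nonneg fun j _ => hg0 _ _ _ _)
  refine (Finset.sum_le_sum fun x _ => hpt x).trans ?_
  rw [Finset.sum_comm]
  have hy : ∀ y ∈ (Finset.univ : Finset (Fin r)).powersetCard l,
      ∑ x : Fin k → Fin r → Bool, 1 / (r.choose l : ℝ) * ∑ u ∈ yᶜ, ∏ j, g y u j (x j) ≤
      1 / (r.choose l : ℝ) * (r * (2 / 3) ^ (k - 1)) := by
    intro y hy
    have hy := Finset.mem_powersetCard_univ.1 hy
    rw [← Finset.mul_sum, Finset.sum_comm]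
    refine mul_le_mul_of_nonneg_left ?_ (by positivity)
    have hu : ∀ u ∈ yᶜ, ∑ x : Fin k → Fin r → Bool, ∏ j, g y u j (x j) ≤ (2 / 3) ^ (k - 1) := by
      intro u hu
      rw [sum_prod_apply (g y u), ← Finset.mul_prod_erase Finset.univ _ (Finset.mem_univ i)]
      have h1 : ∑ a, g y u i a = 1 := by
        simp only [hg, if_true]
        rw [sum_comp_toSet (fun x => meetMass l 1 y x)]
        exact sum_meetMass hl hr hl hy
      rw [h1, one_mul]
      have h2 : ∀ j ∈ Finset.univ.erase i, ∑ a, g y u j a ≤ 2 / 3 := by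
        intro j hj
        simp only [hg, Finset.ne_of_mem_erase hj, if_false]
        rw [sum_comp_toSet (fun x => if u ∈ x then 0 else meetMass l 0 y x)]
        exact sum_meetMass_zero_avoiding_le hl hr hy (Finset.mem_compl.1 hu)
      refine (Finset.prod_le_prod (fun j _ => Finset.sum_nonneg fun a _ => hg0 _ _ _ _)
        h2).trans (le_of_eq ?_)
      rw [Finset.prod_const, Finset.card_erase_of_mem (Finset.mem_univ _), Finset.card_univ,
        Fintype.card_fin]
    refine (Finset.sum_le_card_nsmul _ _ _ hu).trans ?_
    rw [nsmul_eq_mul]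
    refine mul_le_mul_of_nonneg_right ?_ (by positivity)
    have := Finset.card_le_univ yᶜ
    rw [Fintype.card_fin] at this
    exact_mod_cast this
  refine (Finset.sum_le_sum hy).trans (le_of_eq ?_)
  have hpos : (r.choose l : ℝ) ≠ 0 := by exact_mod_cast (Nat.choose_pos (by omega)).ne'
  rw [Finset.sum_const, Finset.card_powersetCard, Finset.card_univ, Fintype.card_fin,
    nsmul_eq_mul]
  field_simp

/-! ### Corruption of rectangles in the input space -/

open Classical in
/-- A rectangle has almost as much mass when an intersection is planted at site `i` as when all
sets are disjoint from `y`: given `y`, the input of site `i` and the other inputs are independent,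
so this is the two-party corruption bound. -/
lemma plantedLaw_corruption (hl : 0 < l) (hr : r + 1 = 4 * l) {m : ℕ} (i : Fin (m + 1))
    {Q : Set (Fin (m + 1) → Fin r → Bool)} (hQ : Protocol.IsRectangle i Q) :
    1 / 128 * ∑ x, (if x ∈ Q then plantedLaw l i 0 x else 0) - l * (98 / 100) ^ l ≤
      ∑ x, (if x ∈ Q then plantedLaw l i 1 x else 0) := by
  set A : Finset (Finset (Fin r)) :=
    Finset.univ.filter fun s => ∃ x ∈ Q, toSet (x i) = s with hA
  set ρ : Finset (Fin r) → ℝ := fun y => ∑ z : Fin m → Fin r → Bool,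
    if ∃ a, i.insertNth a z ∈ Q then ∏ j, meetMass l 0 y (toSet (z j)) else 0 with hρ
  have hmem : ∀ (a : Fin r → Bool) (z : Fin m → Fin r → Bool),
      (i.insertNth a z : Fin (m + 1) → Fin r → Bool) ∈ Q ↔
        toSet a ∈ A ∧ ∃ b, (i.insertNth b z : Fin (m + 1) → Fin r → Bool) ∈ Q := by
    intro a z
    constructor
    · intro h
      exact ⟨Finset.mem_filter.2 ⟨Finset.mem_univ _, _, h, by simp⟩, a, h⟩
    · rintro ⟨ha, b, hb⟩
      obtain ⟨-, x, hx, hxa⟩ := Finset.mem_filter.1 ha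
      have := hQ x hx _ hb
      rwa [toSet_injective hxa, Fin.update_insertNth] at this
  have hsum : ∀ p : ℕ, ∑ x, (if x ∈ Q then plantedLaw l i p x else 0) =
      ∑ y ∈ (Finset.univ : Finset (Fin r)).powersetCard l,
        1 / (r.choose l : ℝ) * ((∑ s ∈ A, meetMass l p y s) * ρ y) := by
    intro p
    have h1 : ∀ x : Fin (m + 1) → Fin r → Bool, (if x ∈ Q then plantedLaw l i p x else 0) =
        ∑ y ∈ (Finset.univ : Finset (Fin r)).powersetCard l, 1 / (r.choose l : ℝ) *
          (if x ∈ Q then ∏ j, meetMass l (if j = i then p else 0) y (toSet (x j)) else 0) := by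
      intro x
      split_ifs
      · rfl
      · simp
    simp only [h1]
    rw [Finset.sum_comm]
    refine Finset.sum_congr rfl fun y _ => ?_
    rw [← Finset.mul_sum]
    congr 1
    rw [← Equiv.sum_comp (Fin.insertNthEquiv (fun _ => Fin r → Bool) i), Fintype.sum_prod_type]
    have h2 : ∑ s ∈ A, meetMass l p y s =
        ∑ a : Fin r → Bool, if toSet a ∈ A then meetMass l p y (toSet a) else 0 := by
      rw [sum_comp_toSet (fun s => if s ∈ A then meetMass l p y s else 0)]
      simp
    rw [h2, Finset.sum_mul]
    refine Finset.sum_congr rfl fun a _ => ?_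
    rw [hρ, Finset.mul_sum]
    refine Finset.sum_congr rfl fun z _ => ?_
    change (if (i.insertNth a z : Fin (m + 1) → Fin r → Bool) ∈ Q then
      ∏ j, meetMass l (if j = i then p else 0) y
        (toSet ((i.insertNth a z : Fin (m + 1) → Fin r → Bool) j)) else 0) = _
    simp only [hmem a z, Fin.prod_univ_succAbove _ i,
      Fin.insertNth_apply_same, Fin.insertNth_apply_succAbove, if_true, Fin.succAbove_ne,
      if_false]
    by_cases ha : toSet a ∈ A <;>
      by_cases hz : ∃ b, (i.insertNth b z : Fin (m + 1) → Fin r → Bool) ∈ Q <;>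
      simp [ha, hz]
  rw [hsum, hsum]
  have hnn : ∀ y (z : Fin m → Fin r → Bool), 0 ≤ ∏ j, meetMass l 0 y (toSet (z j)) :=
    fun y z => Finset.prod_nonneg fun j _ => meetMass_nonneg _ _ _
  refine meetMass_corruption hl hr A ρ (fun y _ => ?_) fun y hy => ?_
  · refine Finset.sum_nonneg fun z _ => ?_
    split_ifs
    · exact hnn y z
    · exact le_rfl
  · calc ρ y ≤ ∑ z : Fin m → Fin r → Bool, ∏ j, meetMass l 0 y (toSet (z j)) := by
          refine Finset.sum_le_sum fun z _ => ?_
          split_ifs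
          · exact le_rfl
          · exact hnn y z
      _ = 1 := by
          rw [sum_prod_apply (fun _ a => meetMass l 0 y (toSet a)),
            sum_comp_toSet (fun x => meetMass l 0 y x), sum_meetMass hl hr (Nat.zero_le _) hy]
          simp

end Planted

/-! ### From a cheap protocol to a corruption inequality -/

section Assembly

variable {k r l : ℕ}

/-- A law dominated by a multiple of the input distribution puts little mass on errors. -/
lemma sum_error_le {P : Protocol k (Fin r → Bool)} {C : ℕ} (hC : P.cost ≤ C)
    {μ ν : (Fin k → Fin r → Bool) → ℝ} {f : (Fin k → Fin r → Bool) → Bool} {a ε : ℝ}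
    (ha : 0 < a) (hμν : ∀ x, a * ν x ≤ μ x) (herr : P.errorProb μ f ≤ ε) :
    ∑ x, (if P.outputAt C x = f x then 0 else ν x) ≤ ε / a := by
  rw [le_div_iff₀ ha, mul_comm, Finset.mul_sum]
  refine le_trans (Finset.sum_le_sum fun x _ => ?_) herr
  rw [Protocol.outputs_iff (Protocol.haltsBy_of_cost_le hC x)]
  split_ifs
  · simp
  · exact hμν x

/-- Some site sees, on average over a probability law, at most `2 C / k` of the bits. -/
lemma exists_site_sum_length_view_le [NeZero k] (P : Protocol k (Fin r → Bool)) (C : ℕ)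
    {ν : (Fin k → Fin r → Bool) → ℝ} (hν : ∀ x, 0 ≤ ν x) (hν1 : ∑ x, ν x = 1) :
    ∃ i, ∑ x, ν x * (view i (P.run x C)).length ≤ 2 * C / k := by
  have hk : (0 : ℝ) < k := by exact_mod_cast Nat.pos_of_ne_zero (NeZero.ne k)
  have htot : ∑ i, ∑ x, ν x * ((view i (P.run x C)).length : ℝ) ≤
      ∑ _i : Fin k, (2 * C / k : ℝ) := by
    rw [Finset.sum_comm, Finset.sum_const, Finset.card_univ, Fintype.card_fin, nsmul_eq_mul,
      mul_div_cancel₀ _ hk.ne']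
    calc ∑ x, ∑ i, ν x * ((view i (P.run x C)).length : ℝ)
        ≤ ∑ x, ν x * (2 * C) := by
          refine Finset.sum_le_sum fun x _ => ?_
          rw [← Finset.mul_sum]
          refine mul_le_mul_of_nonneg_left ?_ (hν x)
          have h1 := Protocol.sum_length_view_le (P.run x C)
          have h2 := P.length_run_le x C
          exact_mod_cast h1.trans (Nat.mul_le_mul_left 2 h2)
      _ = 2 * C := by rw [← Finset.sum_mul, hν1, one_mul]
  obtain ⟨i, -, hi⟩ := Finset.exists_le_of_sum_le Finset.univ_nonempty htot
  exact ⟨i, hi⟩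

open Classical in
/-- The inputs answered `false` on which site `i` sees at most `T` bits split into the classes
given by the view of site `i` and by whether it is the reporter. -/
lemma sum_short_false_eq (P : Protocol k (Fin r → Bool)) (C : ℕ) (i : Fin k) (T : ℕ)
    (ν : (Fin k → Fin r → Bool) → ℝ) :
    ∑ x, (if P.outputAt C x = false ∧ (view i (P.run x C)).length ≤ T then ν x else 0) =
      ∑ p ∈ P.shortViews C i T ×ˢ (Finset.univ : Finset Bool),
        ∑ x, if x ∈ P.viewClass C i p.1 p.2 then ν x else 0 := by
  rw [Finset.sum_comm]
  refine Finset.sum_congr rfl fun x _ => ?_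
  split_ifs with h
  · have hmem : (view i (P.run x C), decide (P.reporter (P.run x C) = i)) ∈
        P.shortViews C i T ×ˢ (Finset.univ : Finset Bool) := by
      simp only [Finset.mem_product, Finset.mem_univ, and_true, Protocol.shortViews,
        Finset.mem_filter, Finset.mem_image, true_and]
      exact ⟨⟨x, rfl⟩, h.2⟩
    rw [Finset.sum_eq_single_of_mem _ hmem]
    · exact (if_pos ⟨rfl, rfl, h.1⟩).symm
    · rintro ⟨v, b⟩ _ hne
      refine if_neg fun hx => hne ?_
      obtain ⟨hv, hb, -⟩ := hx
      exact Prod.ext hv.symm hb.symm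
  · refine (Finset.sum_eq_zero fun p hp => if_neg fun hx => h ⟨hx.2.2, ?_⟩).symm
    have := (Finset.mem_filter.1 (Finset.mem_product.1 hp).1).2
    rw [hx.1]
    exact this

/-- The bound on the communication `C` extracted from the corruption bound, for a truncation
threshold `T` on the number of bits seen by one site. -/
lemma corruption_of_cost_le (hk : 2 ≤ k) (hl : 0 < l) (hr : r + 1 = 4 * l)
    {P : Protocol k (Fin r → Bool)} {C : ℕ} (hC : P.cost ≤ C)
    (herr : P.errorProb (zeta k r) (thresh ((3 * r - 1) / 4)) ≤ 1 / (k : ℝ) ^ 4) (T : ℕ) :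
    1 / 128 * (1 - 2 / (k : ℝ) ^ 4 - 2 * C / (k * (T + 1))) -
        2 * 4 ^ (T + 1) * (l * (98 / 100) ^ l) ≤
      2 / (k : ℝ) ^ 2 + r * (2 / 3) ^ (k - 1) := by
  obtain ⟨m, rfl⟩ : ∃ m, k = m + 1 := ⟨k - 1, by omega⟩
  have hkpos : (0 : ℝ) < (m + 1 : ℕ) := by positivity
  set f := thresh (k := m + 1) (r := r) ((3 * r - 1) / 4) with hf
  set ν₀ : (Fin (m + 1) → Fin r → Bool) → ℝ := plantedLaw l 0 0 with hν₀
  have hν₀0 : ∀ x, 0 ≤ ν₀ x := fun x => plantedLaw_nonneg _ _ _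
  have hν₀1 : ∑ x, ν₀ x = 1 := sum_plantedLaw_zero hl hr _
  obtain ⟨i, hi⟩ := exists_site_sum_length_view_le P C hν₀0 hν₀1
  have hν₀i : ∀ x, plantedLaw l i 0 x = ν₀ x := fun x => plantedLaw_zero_eq _ _ _
  set ν₁ : (Fin (m + 1) → Fin r → Bool) → ℝ := plantedLaw l i 1 with hν₁
  have hν₁0 : ∀ x, 0 ≤ ν₁ x := fun x => plantedLaw_nonneg _ _ _
  have herr0 := sum_error_le hC (a := 1 / 2) (by norm_num)
    (fun x => (zeta_ge_plantedLaw hk hl hr 0 x).1) herr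
  have herr1 := sum_error_le hC (a := 1 / 2 * (1 / ((m + 1 : ℕ) : ℝ) ^ 2)) (by positivity)
    (fun x => (zeta_ge_plantedLaw hk hl hr i x).2) herr
  -- Without a planted intersection, the short inputs answered `false` have most of the mass.
  have hZ0 : 1 - 2 / ((m + 1 : ℕ) : ℝ) ^ 4 - 2 * C / ((m + 1 : ℕ) * (T + 1)) ≤
      ∑ x, (if P.outputAt C x = false ∧ (view i (P.run x C)).length ≤ T then ν₀ x else 0) := by
    have hpt : ∀ x, ν₀ x ≤
        (if P.outputAt C x = false ∧ (view i (P.run x C)).length ≤ T then ν₀ x else 0) +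
        (if P.outputAt C x = f x then 0 else ν₀ x) +
        1 / (T + 1) * (ν₀ x * (view i (P.run x C)).length) := by
      intro x
      have hlen : 0 ≤ 1 / ((T : ℝ) + 1) * (ν₀ x * (view i (P.run x C)).length) :=
        mul_nonneg (by positivity) (mul_nonneg (hν₀0 x) (by positivity))
      by_cases h0 : ν₀ x = 0
      · simp [h0]
      · have hfx : f x = false := thresh_eq_false_of_plantedLaw_zero_ne_zero hr 0 h0
        rw [hfx]
        by_cases ho : P.outputAt C x = false
        · by_cases hT : (view i (P.run x C)).length ≤ T
          · simp only [ho, hT, and_self, if_true]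
            linarith
          · have : (1 : ℝ) ≤ 1 / ((T : ℝ) + 1) * (view i (P.run x C)).length := by
              rw [one_div_mul_eq_div, le_div_iff₀ (by positivity), one_mul]
              exact_mod_cast not_le.1 hT
            have := mul_le_mul_of_nonneg_left this (hν₀0 x)
            simp only [ho, hT, and_false, if_false, if_true]
            linarith
        · simp only [ho, Bool.true_eq_false, false_and, if_false]
          linarith
    have hsum := Finset.sum_le_sum fun x (_ : x ∈ Finset.univ) => hpt x
    rw [hν₀1, Finset.sum_add_distrib, Finset.sum_add_distrib, ← Finset.mul_sum] at hsum
    have h2 : 1 / ((T : ℝ) + 1) * ∑ x, ν₀ x * ((view i (P.run x C)).length : ℝ) ≤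
        2 * C / ((m + 1 : ℕ) * (T + 1)) := by
      refine (mul_le_mul_of_nonneg_left hi (by positivity)).trans (le_of_eq ?_)
      rw [one_div_mul_eq_div, div_div]
    have h3 : 1 / ((m + 1 : ℕ) : ℝ) ^ 4 / (1 / 2) = 2 / ((m + 1 : ℕ) : ℝ) ^ 4 := by
      rw [div_div_eq_mul_div, div_one, one_div_mul_eq_div]
    rw [h3] at herr0
    linarith
  -- With a planted intersection, these inputs are mostly errors.
  have hZ1 : ∑ x, (if P.outputAt C x = false ∧ (view i (P.run x C)).length ≤ T
        then ν₁ x else 0) ≤ 2 / ((m + 1 : ℕ) : ℝ) ^ 2 + r * (2 / 3) ^ (m + 1 - 1) := by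
    have hcov := sum_plantedLaw_one_thresh_false_le (k := m + 1) hl hr i
    have h3 : 1 / ((m + 1 : ℕ) : ℝ) ^ 4 / (1 / 2 * (1 / ((m + 1 : ℕ) : ℝ) ^ 2)) =
        2 / ((m + 1 : ℕ) : ℝ) ^ 2 := by
      field_simp
    rw [h3] at herr1
    refine le_trans ?_ (add_le_add herr1 hcov)
    rw [← Finset.sum_add_distrib]
    refine Finset.sum_le_sum fun x _ => ?_
    have h0 := hν₁0 x
    by_cases ho : P.outputAt C x = false
    · cases hfx : f x
      · simp only [ho, ← hf, hfx, if_true, true_and]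
        split_ifs <;> linarith
      · simp only [ho, ← hf, hfx, true_and]
        simp only [Bool.false_eq_true, Bool.true_eq_false, if_false]
        split_ifs <;> linarith
    · simp only [ho, Bool.true_eq_false, false_and, if_false]
      split_ifs <;> linarith
  -- These inputs form few rectangles, and each of them obeys the corruption bound.
  have hcorr : 1 / 128 * ∑ x, (if P.outputAt C x = false ∧ (view i (P.run x C)).length ≤ T
        then ν₀ x else 0) - 2 * 4 ^ (T + 1) * (l * (98 / 100) ^ l) ≤
      ∑ x, (if P.outputAt C x = false ∧ (view i (P.run x C)).length ≤ T then ν₁ x else 0) := by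
    classical
    rw [sum_short_false_eq, sum_short_false_eq]
    have hrect := Finset.sum_le_sum (s := P.shortViews C i T ×ˢ (Finset.univ : Finset Bool))
      fun p _ => plantedLaw_corruption hl hr i (P.isRectangle_viewClass C i p.1 p.2)
    rw [Finset.sum_sub_distrib, ← Finset.mul_sum, Finset.sum_const, nsmul_eq_mul] at hrect
    simp only [hν₀i] at hrect
    refine le_trans (sub_le_sub_left (mul_le_mul_of_nonneg_right ?_ (by positivity)) _) hrect
    have hcard := P.card_shortViews_le C i T
    rw [Finset.card_product, Finset.card_univ, Fintype.card_bool, mul_comm]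
    exact_mod_cast Nat.mul_le_mul_left 2 hcard
  linarith

end Assembly

/-! ### Choice of constants -/

open Filter Topology in
lemma exists_forall_ge_small_error :
    ∃ K : ℕ, ∀ n ≥ K, 2 / (n : ℝ) ^ 2 + 3 / 2 * (8 / 10) ^ n ≤ 1 / 1024 ∧
      8 * ((n : ℝ) * (99 / 100) ^ n) ≤ 1 / 1024 := by
  have h1 : Tendsto (fun n : ℕ => 2 / (n : ℝ) ^ 2 + 3 / 2 * (8 / 10 : ℝ) ^ n) atTop (𝓝 0) := by
    have ha : Tendsto (fun n : ℕ => 2 / (n : ℝ) ^ 2) atTop (𝓝 0) :=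
      tendsto_const_nhds.div_atTop
        ((tendsto_pow_atTop two_ne_zero).comp tendsto_natCast_atTop_atTop)
    have hb := (tendsto_pow_atTop_nhds_zero_of_lt_one (r := (8 / 10 : ℝ)) (by norm_num)
      (by norm_num)).const_mul (3 / 2)
    simpa using ha.add hb
  have h2 : Tendsto (fun n : ℕ => 8 * ((n : ℝ) * (99 / 100 : ℝ) ^ n)) atTop (𝓝 0) := by
    simpa using (tendsto_self_mul_const_pow_of_lt_one (r := (99 / 100 : ℝ)) (by norm_num)
      (by norm_num)).const_mul 8
  have h := (h1.eventually_le_const (u := 1 / 1024) (by norm_num)).and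
    (h2.eventually_le_const (u := 1 / 1024) (by norm_num))
  exact eventually_atTop.1 h

/-- Truncation at `l / 140` bits leaves so few rectangles that their total error is small. -/
lemma two_mul_four_pow_mul_le (l : ℕ) :
    2 * 4 ^ (l / 140 + 1) * ((l : ℝ) * (98 / 100) ^ l) ≤ 8 * (l * (99 / 100) ^ l) := by
  have h1 : (4 : ℝ) ^ (l / 140) ≤ (101 / 100) ^ l := by
    calc (4 : ℝ) ^ (l / 140) ≤ ((101 / 100 : ℝ) ^ 140) ^ (l / 140) :=
          pow_le_pow_left₀ (by norm_num) (by norm_num) _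
      _ = (101 / 100 : ℝ) ^ (140 * (l / 140)) := by rw [pow_mul]
      _ ≤ (101 / 100 : ℝ) ^ l := pow_le_pow_right₀ (by norm_num) (Nat.mul_div_le _ _)
  have h2 : (101 / 100 : ℝ) ^ l * (98 / 100) ^ l ≤ (99 / 100) ^ l := by
    rw [← mul_pow]
    exact pow_le_pow_left₀ (by norm_num) (by norm_num) _
  calc 2 * 4 ^ (l / 140 + 1) * ((l : ℝ) * (98 / 100) ^ l)
      = 8 * l * (4 ^ (l / 140) * (98 / 100) ^ l) := by ring
    _ ≤ 8 * l * ((101 / 100) ^ l * (98 / 100) ^ l) :=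
        mul_le_mul_of_nonneg_left (mul_le_mul_of_nonneg_right h1 (by positivity)) (by positivity)
    _ ≤ 8 * l * (99 / 100) ^ l := mul_le_mul_of_nonneg_left h2 (by positivity)
    _ = 8 * (l * (99 / 100) ^ l) := by ring

/-- The probability of an uncovered element is exponentially small in `k`. -/
lemma mul_two_thirds_pow_le {k r : ℕ} (hk : 1 ≤ k) (hr : 0 < r)
    (h : 4 * Real.logb 2 r ≤ k) : (r : ℝ) * (2 / 3) ^ (k - 1) ≤ 3 / 2 * (8 / 10) ^ k := by
  have hr' : (0 : ℝ) < r := by exact_mod_cast hr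
  have h4 : (r : ℝ) ^ 4 ≤ 2 ^ k := by
    have : Real.logb 2 ((r : ℝ) ^ 4) ≤ k := by
      rw [Real.logb_pow]
      exact_mod_cast h
    rw [Real.logb_le_iff_le_rpow (by norm_num) (by positivity), Real.rpow_natCast] at this
    exact this
  have h5 : (r : ℝ) ≤ (12 / 10) ^ k := by
    refine le_of_pow_le_pow_left₀ (n := 4) (by norm_num) (by positivity) (h4.trans ?_)
    rw [← pow_mul, mul_comm k 4, pow_mul]
    exact pow_le_pow_left₀ (by norm_num) (by norm_num) _
  have h6 : (2 / 3 : ℝ) ^ (k - 1) = 3 / 2 * (2 / 3) ^ k := by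
    obtain ⟨m, rfl⟩ : ∃ m, k = m + 1 := ⟨k - 1, by omega⟩
    rw [Nat.add_sub_cancel, pow_succ]
    ring
  calc (r : ℝ) * (2 / 3) ^ (k - 1) ≤ (12 / 10) ^ k * (3 / 2 * (2 / 3) ^ k) := by
        rw [h6]
        exact mul_le_mul_of_nonneg_right h5 (by positivity)
    _ = 3 / 2 * ((12 / 10) * (2 / 3)) ^ k := by rw [mul_pow]; ring
    _ = 3 / 2 * (8 / 10) ^ k := by norm_num

theorem mainTheorem1 :
    ∃ c : ℝ, 0 < c ∧ ∃ ck : ℝ, 0 < ck ∧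
      ∀ k r : ℕ, 4 ∣ r + 1 → ck * Real.logb 2 (r : ℝ) ≤ (k : ℝ) → k ≤ r →
        ENNReal.ofReal (c * (k : ℝ) * (r : ℝ)) ≤
          ((distComplexity (zeta k r) (thresh ((3 * r - 1) / 4)) (1 / (k : ℝ) ^ 4) : ℕ∞) :
            ENNReal) := by
  obtain ⟨K, hK⟩ := exists_forall_ge_small_error
  refine ⟨1 / 4480, by norm_num, 4 * K + 4, by positivity, fun k r hdvd hlog hkr => ?_⟩
  obtain ⟨l, hr⟩ := hdvd
  have hl : 0 < l := by omega
  have hr3 : 3 ≤ r := by omega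
  have hlog1 : 1 ≤ Real.logb 2 (r : ℝ) := by
    rw [Real.le_logb_iff_rpow_le (by norm_num) (by positivity), Real.rpow_one]
    exact_mod_cast (by omega : 2 ≤ r)
  have hkK : 4 * K + 4 ≤ k := by
    have h : (4 * K + 4 : ℝ) * 1 ≤ k := (mul_le_mul_of_nonneg_left hlog1 (by positivity)).trans hlog
    rw [mul_one] at h
    exact_mod_cast h
  have hlog4 : 4 * Real.logb 2 r ≤ k := by
    refine le_trans (mul_le_mul_of_nonneg_right ?_ (by linarith)) hlog
    have : (0 : ℝ) ≤ K := by positivity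
    linarith
  have hsmallk := (hK k (by omega)).1
  have hsmalll := (hK l (by omega)).2
  have hcov := mul_two_thirds_pow_le (by omega) (by omega) hlog4
  have hkpos : (0 : ℝ) < k := by exact_mod_cast (by omega : 0 < k)
  have hlpos : (0 : ℝ) < l := by exact_mod_cast hl
  suffices h : ((⌈1 / 4480 * (k : ℝ) * r⌉₊ : ℕ) : ℕ∞) ≤
      distComplexity (zeta k r) (thresh ((3 * r - 1) / 4)) (1 / (k : ℝ) ^ 4) by
    refine le_trans ?_ (ENat.toENNReal_le.2 h)
    rw [ENat.toENNReal_coe, ← ENNReal.ofReal_natCast]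
    exact ENNReal.ofReal_le_ofReal (Nat.le_ceil _)
  refine le_iInf₂ fun P herr => ?_
  by_contra! hlt
  obtain ⟨C, hC⟩ := ENat.ne_top_iff_exists.1 hlt.ne_top
  have hCs : (C : ℝ) < 1 / 4480 * k * r := by
    rw [← hC] at hlt
    exact Nat.lt_ceil.1 (by exact_mod_cast hlt)
  have hmain := corruption_of_cost_le (by omega) hl hr hC.symm.le herr (l / 140)
  have hrect := two_mul_four_pow_mul_le l
  have h1 : 2 / (k : ℝ) ^ 4 ≤ 1 / 4 := by
    rw [div_le_iff₀ (by positivity)]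
    have : (2 : ℝ) ^ 4 ≤ (k : ℝ) ^ 4 :=
      pow_le_pow_left₀ (by norm_num) (by exact_mod_cast (by omega : 2 ≤ k)) _
    linarith
  -- The truncation threshold is a constant fraction of `r`, far above the average `2 C / k`.
  have h2 : 2 * (C : ℝ) / (k * ((l / 140 : ℕ) + 1)) ≤ 1 / 4 := by
    rw [div_le_iff₀ (by positivity)]
    have hT : (l : ℝ) ≤ 140 * ((l / 140 : ℕ) + 1) := by
      exact_mod_cast (by omega : l ≤ 140 * (l / 140 + 1))
    have hrl : (r : ℝ) ≤ 4 * l := by exact_mod_cast (by omega : r ≤ 4 * l)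
    have h3 := mul_le_mul_of_nonneg_left hT hkpos.le
    have h4 := mul_le_mul_of_nonneg_left hrl hkpos.le
    linarith
  linarith
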